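/- **Setting.** Simple types are built from a set of atomic types with $\to$. The order of an atomic type is $1$ and the order of $A\to B$ is $\max(\mathrm{ord}(A)+1,\mathrm{ord}(B))$. In the simply typed $\lambda$-calculus with de Bruijn indices and typed metavariables (unification variables, infinitely many of each type), let $a,b$ be terms of the same type in a context $\Gamma$. A *solution* of the problem $a=b$ is a type-preserving substitution $\theta$ of metavariables by terms of the context $\Gamma$ (which may contain metavariables) with $\theta a=_{\beta\eta}\theta b$, where $\theta X$ is lifted when it is put below abstractions. The problem is *second order* if all types in $\Gamma$ have order at most $2$, the common type of $a$ and $b$ is atomic, and all metavariables of $a$ and $b$ have a type of order at most $2$. The typed $\lambda\sigma$-calculus has terms $1$, $X$, $(a\,b)$, $\lambda_A a$, $a[s]$ and substitutions $\mathrm{id}$, $\uparrow$, $a.s$, $s\circ t$; each metavariable $X$ has a sort $(\Gamma,A)$, meaning $\Gamma\vdash X:A$, with infinitely many metavariables of each sort. The system $\sigma$ consists of the rules $(a\,b)[s]\to(a[s]\;b[s])$, $(\lambda a)[s]\to\lambda(a[1.(s\circ\uparrow)])$, $(a[s])[t]\to a[s\circ t]$, $1[a.s]\to a$, $a[\mathrm{id}]\to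 a$, $(s_1\circ s_2)\circ s_3\to s_1\circ(s_2\circ s_3)$, $(a.s)\circ t\to a[t].(s\circ t)$, $\mathrm{id}\circ s\to s$, $s\circ\mathrm{id}\to s$, $\uparrow\circ(a.s)\to s$, $1.\uparrow\;\to\mathrm{id}$, $1[s].(\uparrow\circ s)\to s$; the system $\lambda\sigma$ has in addition $(\lambda a)\,b\to a[b.\mathrm{id}]$ and $\lambda(a\,1)\to b$ whenever $a=_\sigma b[\uparrow]$. Substitutions of metavariables in $\lambda\sigma$ are sort-preserving and are applied by grafting (replacement without lifting). A *solution for $\sigma$ alone* of a problem $c=d$ between $\lambda\sigma$-terms of the same sort is such a substitution $\theta$ with $\theta c=_\sigma\theta d$. For a $\lambda$-term $a$ in the context $\Gamma$, the precooked term $a_F$ is the $\lambda\sigma$-term obtained by replacing each index $n+1$ by $1[\uparrow^n]$ and each occurrence of a metavariable $X$ of type $A$ below $n$ abstractions by $X[\uparrow^n]$, where $X$ now has the sort $(\Gamma,A)$. **Proposition.** Let $a=b$ be a second order unification problem in the context $\Gamma$. Let $\rho$ be the substitution that maps every metavariable $X$ of sort $(\Gamma,A_1\to\cdots\to A_n\to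 B)$, $B$ atomic, occurring in $a_F$ or $b_F$ to $\lambda_{A_1}\cdots\lambda_{A_n}Y$, where $Y$ is a new metavariable of sort $(A_n.\cdots.A_1.\Gamma,\,B)$ (different $Y$ for different $X$). Then $\rho a_F$ and $\rho b_F$ have unique $\lambda\sigma$-normal forms $\tilde a$ and $\tilde b$, and $a=b$ has a solution in the $\lambda$-calculus if and only if $\tilde a=\tilde b$ has a solution for $\sigma$ alone. -/

import Mathlib

universe u

/-! ### Simple types, contexts, order -/

/-- Simple types over a set `ι` of atomic types. -/
inductive Ty (ι : Type u) : Type u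
  | base : ι → Ty ι
  | arrow : Ty ι → Ty ι → Ty ι

/-- Contexts for de Bruijn indices: the head of the list is the type of index `1`. -/
abbrev Ctx (ι : Type u) : Type u := List (Ty ι)

namespace Ty

/-- The order of a type: atomic types have order `1`, and
`A → B` has order `max (order A + 1) (order B)`. -/
def order {ι : Type u} : Ty ι → ℕ
  | base _ => 1
  | arrow A B => max (A.order + 1) B.order

/-- Being an atomic type. -/
def IsAtomic {ι : Type u} (A : Ty ι) : Prop := ∃ i, A = base i

/-- The atomic type `B` at the end of `A₁ → ⋯ → Aₙ → B`. -/
def target {ι : Type u} : Ty ι → Ty ι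
  | base i => base i
  | arrow _ B => B.target

/-- The context obtained from `Γ` by going below the `n` abstractions of a term
`λ ⋯ λ c` of type `A₁ → ⋯ → Aₙ → B` with `B` atomic, that is, `Aₙ. ⋯ .A₁.Γ`. -/
def bodyCtx {ι : Type u} : Ty ι → Ctx ι → Ctx ι
  | base _, Γ => Γ
  | arrow A B, Γ => B.bodyCtx (A :: Γ)

end Ty

/-- `Depth Γ Θ`: the context `Θ` is `Γ` extended by finitely many variables on top; an
element is the (typed) number of these variables. -/
inductive Depth {ι : Type u} (Γ : Ctx ι) : Ctx ι → Type u
  | zero : Depth Γ Γ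
  | succ {Θ : Ctx ι} {A : Ty ι} : Depth Γ Θ → Depth Γ (A :: Θ)

/-! ### The simply typed λ-calculus with de Bruijn indices and metavariables -/

/-- De Bruijn indices of type `A` in the context `Γ`. -/
inductive Var {ι : Type u} : Ctx ι → Ty ι → Type u
  | zero {Γ : Ctx ι} {A : Ty ι} : Var (A :: Γ) A
  | succ {Γ : Ctx ι} {A B : Ty ι} : Var Γ A → Var (B :: Γ) A

/-- Well-typed λ-terms. A metavariable (a unification variable) is a type together with a
name; it may occur below any number of abstractions. -/
inductive Lam {ι : Type u} : Ctx ι → Ty ι → Type u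
  | var {Γ : Ctx ι} {A : Ty ι} : Var Γ A → Lam Γ A
  | mvar {Γ : Ctx ι} (A : Ty ι) (n : ℕ) : Lam Γ A
  | app {Γ : Ctx ι} {A B : Ty ι} : Lam Γ (.arrow A B) → Lam Γ A → Lam Γ B
  | lam {Γ : Ctx ι} {A B : Ty ι} : Lam (A :: Γ) B → Lam Γ (.arrow A B)

namespace Lam

variable {ι : Type u}

/-- The renaming `ρ` below an abstraction. -/
def liftRen {Γ Δ : Ctx ι} (ρ : ∀ A, Var Γ A → Var Δ A) (B : Ty ι) :
    ∀ A, Var (B :: Γ) A → Var (B :: Δ) A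
  | _, .zero => .zero
  | _, .succ v => .succ (ρ _ v)

/-- Renaming of de Bruijn indices; metavariables are left alone. -/
def ren {Γ Δ : Ctx ι} (ρ : ∀ A, Var Γ A → Var Δ A) {A : Ty ι} : Lam Γ A → Lam Δ A
  | var v => var (ρ _ v)
  | mvar A n => mvar A n
  | app a b => app (ren ρ a) (ren ρ b)
  | lam a => lam (ren (liftRen ρ _) a)

/-- The lifting `a⁺`: every free index is incremented. -/
def shift {Γ : Ctx ι} {A B : Ty ι} (a : Lam Γ A) : Lam (B :: Γ) A :=
  ren (fun _ v => .succ v) a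

/-- The substitution `τ` below an abstraction. -/
def liftSub {Γ Δ : Ctx ι} (τ : ∀ A, Var Γ A → Lam Δ A) (B : Ty ι) :
    ∀ A, Var (B :: Γ) A → Lam (B :: Δ) A
  | _, .zero => var .zero
  | _, .succ v => shift (τ _ v)

/-- Simultaneous capture-avoiding substitution of de Bruijn indices; metavariables are left
alone. -/
def sub {Γ Δ : Ctx ι} (τ : ∀ A, Var Γ A → Lam Δ A) {A : Ty ι} : Lam Γ A → Lam Δ A
  | var v => τ _ v
  | mvar A n => mvar A n
  | app a b => app (sub τ a) (sub τ b)
  | lam a => lam (sub (liftSub τ _) a)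

/-- The substitution `1 ↦ b`, `k + 1 ↦ k`. -/
def single {Γ : Ctx ι} {B : Ty ι} (b : Lam Γ B) : ∀ A, Var (B :: Γ) A → Lam Γ A
  | _, .zero => b
  | _, .succ v => var v

/-- One step of βη-reduction. -/
inductive Step : ∀ {Γ : Ctx ι} {A : Ty ι}, Lam Γ A → Lam Γ A → Prop
  | beta {Γ : Ctx ι} {A B : Ty ι} (a : Lam (A :: Γ) B) (b : Lam Γ A) :
      Step (app (lam a) b) (sub (single b) a)
  | eta {Γ : Ctx ι} {A B : Ty ι} (a : Lam Γ (.arrow A B)) :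
      Step (lam (app (shift a) (var .zero))) a
  | appL {Γ : Ctx ι} {A B : Ty ι} {a a' : Lam Γ (.arrow A B)} (b : Lam Γ A) :
      Step a a' → Step (app a b) (app a' b)
  | appR {Γ : Ctx ι} {A B : Ty ι} (a : Lam Γ (.arrow A B)) {b b' : Lam Γ A} :
      Step b b' → Step (app a b) (app a b')
  | lam {Γ : Ctx ι} {A B : Ty ι} {a a' : Lam (A :: Γ) B} :
      Step a a' → Step (lam a) (lam a')

/-- βη-equality. -/
def Conv {Γ : Ctx ι} {A : Ty ι} : Lam Γ A → Lam Γ A → Prop := Relation.EqvGen Step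

/-- Lifting of a term as many times as the depth says. -/
def shiftBy {Γ Θ : Ctx ι} {A : Ty ι} (a : Lam Γ A) : Depth Γ Θ → Lam Θ A
  | .zero => a
  | .succ d => shift (shiftBy a d)

/-- Capture-avoiding substitution of metavariables by terms of the context `Γ`: an occurrence
of `X` below `d` abstractions is replaced by `θ X` lifted `d` times. -/
def instAt {Γ : Ctx ι} (θ : ∀ A : Ty ι, ℕ → Lam Γ A) {Θ : Ctx ι} {A : Ty ι} :
    Depth Γ Θ → Lam Θ A → Lam Θ A
  | _, var v => var v
  | d, mvar A n => shiftBy (θ A n) d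
  | d, app a b => app (instAt θ d a) (instAt θ d b)
  | d, lam a => lam (instAt θ d.succ a)

/-- The term `θ a`, for a term `a` of the context `Γ`. -/
def inst {Γ : Ctx ι} {A : Ty ι} (θ : ∀ A : Ty ι, ℕ → Lam Γ A) (a : Lam Γ A) : Lam Γ A :=
  instAt θ .zero a

/-- The metavariables of a term. -/
def mvars {Γ : Ctx ι} {A : Ty ι} : Lam Γ A → Set (Ty ι × ℕ)
  | var _ => ∅
  | mvar A n => {(A, n)}
  | app a b => mvars a ∪ mvars b
  | lam a => mvars a

/-- The unification problem `a = b` has a solution in the λ-calculus. -/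
def HasSolution {Γ : Ctx ι} {A : Ty ι} (a b : Lam Γ A) : Prop :=
  ∃ θ : ∀ A : Ty ι, ℕ → Lam Γ A, Conv (inst θ a) (inst θ b)

/-- The unification problem `a = b` is a second order unification problem. -/
structure IsSecondOrder {Γ : Ctx ι} {A : Ty ι} (a b : Lam Γ A) : Prop where
  ctx : ∀ B ∈ Γ, B.order ≤ 2
  atomic : A.IsAtomic
  mvars : ∀ X ∈ mvars a ∪ mvars b, X.1.order ≤ 2

end Lam

/-! ### The typed λσ-calculus -/

/-- The two kinds of λσ-expressions: terms `Γ ⊢ a : A` and substitutions `Γ ⊢ s ▷ Δ`. -/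
inductive Kind (ι : Type u) : Type u
  | tm : Ctx ι → Ty ι → Kind ι
  | sb : Ctx ι → Ctx ι → Kind ι

/-- Well-typed λσ-expressions. A metavariable is a sort `(Γ, A)` together with a name; there
are no substitution metavariables. -/
inductive Exp {ι : Type u} : Kind ι → Type u
  /-- The index `1`. -/
  | one {Γ : Ctx ι} {A : Ty ι} : Exp (.tm (A :: Γ) A)
  /-- The metavariable of sort `(Γ, A)` with name `n`. -/
  | mvar (Γ : Ctx ι) (A : Ty ι) (n : ℕ) : Exp (.tm Γ A)
  /-- Application `(a b)`. -/
  | app {Γ : Ctx ι} {A B : Ty ι} :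
      Exp (.tm Γ (.arrow A B)) → Exp (.tm Γ A) → Exp (.tm Γ B)
  /-- Abstraction `λ_A a`. -/
  | lam {Γ : Ctx ι} {A B : Ty ι} : Exp (.tm (A :: Γ) B) → Exp (.tm Γ (.arrow A B))
  /-- Closure `a[s]`. -/
  | clos {Γ Δ : Ctx ι} {A : Ty ι} : Exp (.tm Δ A) → Exp (.sb Γ Δ) → Exp (.tm Γ A)
  /-- The identity substitution `id`. -/
  | id {Γ : Ctx ι} : Exp (.sb Γ Γ)
  /-- The shift `↑`. -/
  | shift {Γ : Ctx ι} {A : Ty ι} : Exp (.sb (A :: Γ) Γ)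
  /-- The substitution `a.s`. -/
  | cons {Γ Δ : Ctx ι} {A : Ty ι} :
      Exp (.tm Γ A) → Exp (.sb Γ Δ) → Exp (.sb Γ (A :: Δ))
  /-- Composition `s ∘ t` (first `s`, then `t`). -/
  | comp {Γ Δ Θ : Ctx ι} : Exp (.sb Δ Θ) → Exp (.sb Γ Δ) → Exp (.sb Γ Θ)

namespace Exp

variable {ι : Type u}

/-- The rules of `σ`, at the root of an expression. -/
inductive SigmaRule : ∀ {k : Kind ι}, Exp k → Exp k → Prop
  /-- `(a b)[s] → (a[s] b[s])` -/
  | app {Γ Δ : Ctx ι} {A B : Ty ι} (a : Exp (.tm Δ (.arrow A B))) (b : Exp (.tm Δ A))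
      (s : Exp (.sb Γ Δ)) :
      SigmaRule (clos (app a b) s) (app (clos a s) (clos b s))
  /-- `(λ a)[s] → λ (a[1.(s ∘ ↑)])` -/
  | abs {Γ Δ : Ctx ι} {A B : Ty ι} (a : Exp (.tm (A :: Δ) B)) (s : Exp (.sb Γ Δ)) :
      SigmaRule (clos (lam a) s) (lam (clos a (cons one (comp s shift))))
  /-- `a[s][t] → a[s ∘ t]` -/
  | clos {Γ Δ Θ : Ctx ι} {A : Ty ι} (a : Exp (.tm Θ A)) (s : Exp (.sb Δ Θ))
      (t : Exp (.sb Γ Δ)) :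
      SigmaRule (clos (clos a s) t) (clos a (comp s t))
  /-- `1[a.s] → a` -/
  | varCons {Γ Δ : Ctx ι} {A : Ty ι} (a : Exp (.tm Γ A)) (s : Exp (.sb Γ Δ)) :
      SigmaRule (clos one (cons a s)) a
  /-- `a[id] → a` -/
  | id {Γ : Ctx ι} {A : Ty ι} (a : Exp (.tm Γ A)) : SigmaRule (clos a id) a
  /-- `(s₁ ∘ s₂) ∘ s₃ → s₁ ∘ (s₂ ∘ s₃)` -/
  | assoc {Γ Δ Θ Ξ : Ctx ι} (s₁ : Exp (.sb Θ Ξ)) (s₂ : Exp (.sb Δ Θ))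
      (s₃ : Exp (.sb Γ Δ)) :
      SigmaRule (comp (comp s₁ s₂) s₃) (comp s₁ (comp s₂ s₃))
  /-- `(a.s) ∘ t → a[t].(s ∘ t)` -/
  | map {Γ Δ Θ : Ctx ι} {A : Ty ι} (a : Exp (.tm Δ A)) (s : Exp (.sb Δ Θ))
      (t : Exp (.sb Γ Δ)) :
      SigmaRule (comp (cons a s) t) (cons (clos a t) (comp s t))
  /-- `id ∘ s → s` -/
  | idL {Γ Δ : Ctx ι} (s : Exp (.sb Γ Δ)) : SigmaRule (comp id s) s
  /-- `s ∘ id → s` -/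
  | idR {Γ Δ : Ctx ι} (s : Exp (.sb Γ Δ)) : SigmaRule (comp s id) s
  /-- `↑ ∘ (a.s) → s` -/
  | shiftCons {Γ Δ : Ctx ι} {A : Ty ι} (a : Exp (.tm Γ A)) (s : Exp (.sb Γ Δ)) :
      SigmaRule (comp shift (cons a s)) s
  /-- `1.↑ → id` -/
  | varShift {Γ : Ctx ι} {A : Ty ι} :
      SigmaRule (cons one shift : Exp (.sb (A :: Γ) (A :: Γ))) id
  /-- `1[s].(↑ ∘ s) → s` -/
  | sCons {Γ Δ : Ctx ι} {A : Ty ι} (s : Exp (.sb Γ (A :: Δ))) :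
      SigmaRule (cons (clos one s) (comp shift s)) s

/-- Application of a rule anywhere in an expression. -/
inductive Compat (R : ∀ {k : Kind ι}, Exp k → Exp k → Prop) :
    ∀ {k : Kind ι}, Exp k → Exp k → Prop
  | root {k : Kind ι} {e e' : Exp k} : R e e' → Compat R e e'
  | appL {Γ : Ctx ι} {A B : Ty ι} {a a' : Exp (.tm Γ (.arrow A B))} (b : Exp (.tm Γ A)) :
      Compat R a a' → Compat R (app a b) (app a' b)
  | appR {Γ : Ctx ι} {A B : Ty ι} (a : Exp (.tm Γ (.arrow A B))) {b b' : Exp (.tm Γ A)} :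
      Compat R b b' → Compat R (app a b) (app a b')
  | lam {Γ : Ctx ι} {A B : Ty ι} {a a' : Exp (.tm (A :: Γ) B)} :
      Compat R a a' → Compat R (lam a) (lam a')
  | closL {Γ Δ : Ctx ι} {A : Ty ι} {a a' : Exp (.tm Δ A)} (s : Exp (.sb Γ Δ)) :
      Compat R a a' → Compat R (clos a s) (clos a' s)
  | closR {Γ Δ : Ctx ι} {A : Ty ι} (a : Exp (.tm Δ A)) {s s' : Exp (.sb Γ Δ)} :
      Compat R s s' → Compat R (clos a s) (clos a s')
  | consL {Γ Δ : Ctx ι} {A : Ty ι} {a a' : Exp (.tm Γ A)} (s : Exp (.sb Γ Δ)) :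
      Compat R a a' → Compat R (cons a s) (cons a' s)
  | consR {Γ Δ : Ctx ι} {A : Ty ι} (a : Exp (.tm Γ A)) {s s' : Exp (.sb Γ Δ)} :
      Compat R s s' → Compat R (cons a s) (cons a s')
  | compL {Γ Δ Θ : Ctx ι} {s s' : Exp (.sb Δ Θ)} (t : Exp (.sb Γ Δ)) :
      Compat R s s' → Compat R (comp s t) (comp s' t)
  | compR {Γ Δ Θ : Ctx ι} (s : Exp (.sb Δ Θ)) {t t' : Exp (.sb Γ Δ)} :
      Compat R t t' → Compat R (comp s t) (comp s t')

/-- One step of σ-reduction. -/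
def SigmaStep {k : Kind ι} : Exp k → Exp k → Prop := Compat SigmaRule

/-- Equality modulo `σ` alone. -/
def SigmaConv {k : Kind ι} : Exp k → Exp k → Prop := Relation.EqvGen SigmaStep

/-- The rules of `λσ`, at the root of an expression. -/
inductive LambdaSigmaRule : ∀ {k : Kind ι}, Exp k → Exp k → Prop
  | sigma {k : Kind ι} {e e' : Exp k} : SigmaRule e e' → LambdaSigmaRule e e'
  /-- `(λ a) b → a[b.id]` -/
  | beta {Γ : Ctx ι} {A B : Ty ι} (a : Exp (.tm (A :: Γ) B)) (b : Exp (.tm Γ A)) :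
      LambdaSigmaRule (app (lam a) b) (clos a (cons b id))
  /-- `λ (a 1) → b` if `a` and `b[↑]` are equal modulo `σ` -/
  | eta {Γ : Ctx ι} {A B : Ty ι} (a : Exp (.tm (A :: Γ) (.arrow A B)))
      (b : Exp (.tm Γ (.arrow A B))) :
      SigmaConv a (clos b shift) → LambdaSigmaRule (lam (app a one)) b

/-- One step of λσ-reduction. -/
def LambdaSigmaStep {k : Kind ι} : Exp k → Exp k → Prop := Compat LambdaSigmaRule

/-- `e'` is a λσ-normal form of `e`. -/
def IsNormalFormOf {k : Kind ι} (e' e : Exp k) : Prop :=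
  Relation.ReflTransGen LambdaSigmaStep e e' ∧ ∀ e'' : Exp k, ¬ LambdaSigmaStep e' e''

/-- Application of the substitution `θ` to an expression: metavariables are replaced without
any lifting (grafting). -/
def graft (θ : ∀ (Γ : Ctx ι) (A : Ty ι), ℕ → Exp (.tm Γ A)) : ∀ {k : Kind ι}, Exp k → Exp k
  | _, one => one
  | _, mvar Γ A n => θ Γ A n
  | _, app a b => app (graft θ a) (graft θ b)
  | _, lam a => lam (graft θ a)
  | _, clos a s => clos (graft θ a) (graft θ s)
  | _, id => id
  | _, shift => shift
  | _, cons a s => cons (graft θ a) (graft θ s)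
  | _, comp s t => comp (graft θ s) (graft θ t)

/-- The problem `a = b` has a solution modulo `σ` alone. -/
def HasSigmaSolution {Γ : Ctx ι} {A : Ty ι} (a b : Exp (.tm Γ A)) : Prop :=
  ∃ θ : ∀ (Γ : Ctx ι) (A : Ty ι), ℕ → Exp (.tm Γ A), SigmaConv (graft θ a) (graft θ b)

/-- The metavariables of an expression. -/
def mvars : ∀ {k : Kind ι}, Exp k → Set (Ctx ι × Ty ι × ℕ)
  | _, one => ∅
  | _, mvar Γ A n => {(Γ, A, n)}
  | _, app a b => mvars a ∪ mvars b
  | _, lam a => mvars a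
  | _, clos a s => mvars a ∪ mvars s
  | _, id => ∅
  | _, shift => ∅
  | _, cons a s => mvars a ∪ mvars s
  | _, comp s t => mvars s ∪ mvars t

/-! ### Precooking and the substitution `X ↦ λ ⋯ λ Y` -/

/-- The substitution `↑ⁿ`, with `↑⁰ = id` and `↑ⁿ⁺¹ = ↑ⁿ ∘ ↑`. -/
def shiftPow {Γ Θ : Ctx ι} : Depth Γ Θ → Exp (.sb Θ Γ)
  | .zero => id
  | .succ d => comp (shiftPow d) shift

end Exp

/-- The part of the context that lies below a given index. -/
def Var.rest {ι : Type u} : ∀ {Γ : Ctx ι} {A : Ty ι}, Var Γ A → Ctx ι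
  | _ :: Γ, _, .zero => Γ
  | _, _, .succ v => v.rest

/-- The number of indices before a given one: `n` for the index `n + 1`. -/
def Var.depth {ι : Type u} : ∀ {Γ : Ctx ι} {A : Ty ι} (v : Var Γ A), Depth (A :: v.rest) Γ
  | _, _, .zero => .zero
  | _, _, .succ v => .succ v.depth

namespace Lam

variable {ι : Type u}

/-- Precooking below `d` abstractions: the index `n + 1` becomes `1[↑ⁿ]`, and a metavariable
`X` of type `A` becomes `X[↑ᵈ]`, where `X` is now of sort `(Γ, A)`. -/
def precookAt {Γ : Ctx ι} : ∀ {Θ : Ctx ι} {A : Ty ι}, Depth Γ Θ → Lam Θ A → Exp (.tm Θ A)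
  | _, _, _, var v => .clos .one (Exp.shiftPow v.depth)
  | _, _, d, mvar A n => .clos (.mvar Γ A n) (Exp.shiftPow d)
  | _, _, d, app a b => .app (precookAt d a) (precookAt d b)
  | _, _, d, lam a => .lam (precookAt d.succ a)

/-- The precooking `a_F` of a term `a` of the context `Γ`. -/
def precook {Γ : Ctx ι} {A : Ty ι} (a : Lam Γ A) : Exp (.tm Γ A) := precookAt .zero a

end Lam

namespace Exp

variable {ι : Type u}

/-- The term `λ ⋯ λ Y` of sort `(Γ, A₁ → ⋯ → Aₙ → B)`, where `Y` is the metavariable of sort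
`(Aₙ. ⋯ .A₁.Γ, B)` with name `y`. -/
def lamsMVar : ∀ (A : Ty ι) (Γ : Ctx ι), ℕ → Exp (.tm Γ A)
  | .base i, Γ, y => mvar Γ (.base i) y
  | .arrow A B, Γ, y => lam (lamsMVar B (A :: Γ) y)

/-- The metavariable `Y` that is associated with `X` when the names are chosen by `ν`. -/
def newMVar (ν : Ctx ι → Ty ι → ℕ → ℕ) (X : Ctx ι × Ty ι × ℕ) : Ctx ι × Ty ι × ℕ :=
  (X.2.1.bodyCtx X.1, X.2.1.target, ν X.1 X.2.1 X.2.2)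

/-- The names chosen by `ν` are new with respect to the set `S` of metavariables: different
elements `X` of `S` get different `Y`, and no such `Y` is in `S`. -/
def IsNew (ν : Ctx ι → Ty ι → ℕ → ℕ) (S : Set (Ctx ι × Ty ι × ℕ)) : Prop :=
  Set.InjOn (newMVar ν) S ∧ ∀ X ∈ S, newMVar ν X ∉ S

/-- The result of replacing each metavariable `X` by `λ ⋯ λ Y`. -/
def expand (ν : Ctx ι → Ty ι → ℕ → ℕ) {k : Kind ι} (e : Exp k) : Exp k :=
  graft (fun Γ A n => lamsMVar A Γ (ν Γ A n)) e

end Exp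

/-!
Modulo `σ`, the λσ-terms are *contextual terms*: λ-terms in which every occurrence of a
metavariable of sort `(Δ, A)` carries a tuple of terms for the variables of `Δ`. Evaluation to
contextual terms identifies exactly the σ-equal expressions and turns λσ-reduction into
βη-reduction of contextual terms, which is strongly normalizing and confluent. Hence λσ-normal
forms exist and are unique.

From a σ-solution of `ã = b̃`, forgetting the tuples gives a solution of `a = b`. Conversely, in a
solution `θ` of `a = b` each `θ X` may be taken to be `λ ⋯ λ c` with `c` irreducible, and `Y` is
mapped to `c`. As the problem is second order, the metavariables of `ã` and `b̃` are atomic, and the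
components of their tuples are atomic or variables. Substituting such a tuple in an irreducible
term creates no redex, hence the values of `θ ã` and `θ b̃` are irreducible. Being βη-equal, they
are equal.
-/

open Relation (ReflTransGen)

/-! ### Contextual terms -/

/-- The classifiers of contextual terms: a type, for terms, or a context, for tuples of terms. -/
inductive Obj (ι : Type u) : Type u
  | ty : Ty ι → Obj ι
  | cx : Ctx ι → Obj ι

/-- Contextual terms, in which each occurrence of a metavariable of sort `(Δ, A)` comes with a tuple
of terms for the variables of `Δ`. Terms and tuples form one family, so that a single induction
covers both. -/
inductive CTm {ι : Type u} : Ctx ι → Obj ι → Type u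
  | var {Γ : Ctx ι} {A : Ty ι} : Var Γ A → CTm Γ (.ty A)
  | mvar {Γ : Ctx ι} (Δ : Ctx ι) (A : Ty ι) (n : ℕ) : CTm Γ (.cx Δ) → CTm Γ (.ty A)
  | app {Γ : Ctx ι} {A B : Ty ι} :
      CTm Γ (.ty (.arrow A B)) → CTm Γ (.ty A) → CTm Γ (.ty B)
  | lam {Γ : Ctx ι} {A B : Ty ι} : CTm (A :: Γ) (.ty B) → CTm Γ (.ty (.arrow A B))
  | nil {Γ : Ctx ι} : CTm Γ (.cx [])
  | cons {Γ Δ : Ctx ι} {A : Ty ι} : CTm Γ (.ty A) → CTm Γ (.cx Δ) → CTm Γ (.cx (A :: Δ))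

/-- Renamings of the variables of `Γ` by variables of `Δ`. -/
abbrev Ren {ι : Type u} (Γ Δ : Ctx ι) : Type u := ∀ A, Var Γ A → Var Δ A

/-- Substitutions of the variables of `Γ` by contextual terms over `Δ`. -/
abbrev Env {ι : Type u} (Γ Δ : Ctx ι) : Type u := ∀ A, Var Γ A → CTm Δ (.ty A)

/-- The renaming that adds one variable on top. -/
abbrev Ren.succ {ι : Type u} {Γ : Ctx ι} {B : Ty ι} : Ren Γ (B :: Γ) := fun _ v => .succ v

namespace CTm

open Lam (liftRen)

variable {ι : Type u}

/-- Renaming of the variables of a contextual term. -/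
def ren : ∀ {Γ Δ : Ctx ι} {o : Obj ι}, Ren Γ Δ → CTm Γ o → CTm Δ o
  | _, _, _, ρ, var v => var (ρ _ v)
  | _, _, _, ρ, mvar Θ A n s => mvar Θ A n (ren ρ s)
  | _, _, _, ρ, app a b => app (ren ρ a) (ren ρ b)
  | _, _, _, ρ, lam a => lam (ren (liftRen ρ _) a)
  | _, _, _, _, nil => nil
  | _, _, _, ρ, cons a s => cons (ren ρ a) (ren ρ s)

variable {Γ Δ Θ : Ctx ι} {A B : Ty ι} {o : Obj ι}

/-- Weakening by one variable. -/
abbrev shift (t : CTm Γ o) : CTm (B :: Γ) o := ren Ren.succ t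

/-- The substitution `b.τ`. -/
def consEnv (b : CTm Δ (.ty B)) (τ : Env Γ Δ) : Env (B :: Γ) Δ
  | _, .zero => b
  | _, .succ v => τ _ v

/-- The substitution `τ` below an abstraction. -/
def liftEnv (τ : Env Γ Δ) (B : Ty ι) : Env (B :: Γ) (B :: Δ) :=
  consEnv (var .zero) (fun _ v => shift (τ _ v))

/-- Simultaneous capture-avoiding substitution; in a metavariable it acts on the tuple. -/
def sub : ∀ {Γ Δ : Ctx ι} {o : Obj ι}, Env Γ Δ → CTm Γ o → CTm Δ o
  | _, _, _, τ, var v => τ _ v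
  | _, _, _, τ, mvar Θ A n s => mvar Θ A n (sub τ s)
  | _, _, _, τ, app a b => app (sub τ a) (sub τ b)
  | _, _, _, τ, lam a => lam (sub (liftEnv τ _) a)
  | _, _, _, _, nil => nil
  | _, _, _, τ, cons a s => cons (sub τ a) (sub τ s)

/-- The substitution of the last variable by `b`, which contracts a β-redex. -/
abbrev single (b : CTm Γ (.ty B)) : Env (B :: Γ) Γ := consEnv b (fun _ v => var v)

theorem liftEnv_var_comp (ρ : Ren Γ Δ) (B : Ty ι) :
    liftEnv (fun _ v => var (ρ _ v)) B = fun _ v => var (liftRen ρ B _ v) := by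
  funext A v; cases v <;> rfl

theorem ren_eq_sub (ρ : Ren Γ Δ) (t : CTm Γ o) : ren ρ t = sub (fun _ v => var (ρ _ v)) t := by
  induction t generalizing Δ with
  | lam a ih => simp only [ren, sub, ih, liftEnv_var_comp]
  | _ => simp only [ren, sub, *]

theorem liftEnv_var (Γ : Ctx ι) (B : Ty ι) :
    liftEnv (fun _ v => var v : Env Γ Γ) B = fun _ v => var v := by
  funext A v; cases v <;> rfl

theorem sub_var (t : CTm Γ o) : sub (fun _ v => var v) t = t := by
  induction t with
  | lam a ih => simp only [sub, ih, liftEnv_var]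
  | _ => simp only [sub, *]

theorem liftEnv_comp_liftRen (τ : Env Δ Θ) (ρ : Ren Γ Δ) (B : Ty ι) :
    (fun A v => liftEnv τ B A (liftRen ρ B A v)) = liftEnv (fun _ v => τ _ (ρ _ v)) B := by
  funext A v; cases v <;> rfl

theorem sub_ren (τ : Env Δ Θ) (ρ : Ren Γ Δ) (t : CTm Γ o) :
    sub τ (ren ρ t) = sub (fun _ v => τ _ (ρ _ v)) t := by
  induction t generalizing Δ Θ with
  | lam a ih => simp only [ren, sub, ih, liftEnv_comp_liftRen]
  | _ => simp only [ren, sub, *]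

theorem ren_ren (σ : Ren Δ Θ) (ρ : Ren Γ Δ) (t : CTm Γ o) :
    ren σ (ren ρ t) = ren (fun _ v => σ _ (ρ _ v)) t := by
  simp only [ren_eq_sub σ, sub_ren, ← ren_eq_sub]

theorem ren_liftRen_liftEnv (ρ : Ren Δ Θ) (τ : Env Γ Δ) (B : Ty ι) :
    (fun A v => ren (liftRen ρ B) (liftEnv τ B A v)) = liftEnv (fun _ v => ren ρ (τ _ v)) B := by
  funext A v
  cases v with
  | zero => rfl
  | succ v => exact (ren_ren _ _ _).trans (ren_ren Ren.succ ρ (τ A v)).symm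

theorem ren_sub (ρ : Ren Δ Θ) (τ : Env Γ Δ) (t : CTm Γ o) :
    ren ρ (sub τ t) = sub (fun _ v => ren ρ (τ _ v)) t := by
  induction t generalizing Δ Θ with
  | lam a ih => simp only [sub, ren, ih, ren_liftRen_liftEnv]
  | _ => simp only [sub, ren, *]

theorem sub_liftEnv_shift (τ : Env Γ Δ) (t : CTm Γ o) :
    sub (liftEnv τ B) (shift t) = shift (sub τ t) :=
  (sub_ren _ _ _).trans (ren_sub _ _ _).symm

theorem sub_liftEnv_liftEnv (σ : Env Δ Θ) (τ : Env Γ Δ) (B : Ty ι) :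
    (fun A v => sub (liftEnv σ B) (liftEnv τ B A v)) = liftEnv (fun _ v => sub σ (τ _ v)) B := by
  funext A v
  cases v with
  | zero => rfl
  | succ v => exact sub_liftEnv_shift σ (τ A v)

theorem sub_sub (σ : Env Δ Θ) (τ : Env Γ Δ) (t : CTm Γ o) :
    sub σ (sub τ t) = sub (fun _ v => sub σ (τ _ v)) t := by
  induction t generalizing Δ Θ with
  | lam a ih => simp only [sub, ih, sub_liftEnv_liftEnv]
  | _ => simp only [sub, *]

theorem sub_consEnv_shift (b : CTm Δ (.ty B)) (τ : Env Γ Δ) (t : CTm Γ o) :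
    sub (consEnv b τ) (shift t) = sub τ t := sub_ren _ _ _

theorem sub_single_shift (b : CTm Γ (.ty B)) (t : CTm Γ o) : sub (single b) (shift t) = t := by
  rw [sub_consEnv_shift, sub_var]

theorem sub_single_liftEnv (b : CTm Δ (.ty B)) (τ : Env Γ Δ) (t : CTm (B :: Γ) o) :
    sub (single b) (sub (liftEnv τ B) t) = sub (consEnv b τ) t := by
  rw [sub_sub]; congr 1; funext A v
  cases v
  · rfl
  · exact sub_single_shift _ _

theorem sub_sub_single (b : CTm Γ (.ty B)) (τ : Env Γ Δ) (t : CTm (B :: Γ) o) :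
    sub τ (sub (single b) t) = sub (single (sub τ b)) (sub (liftEnv τ B) t) := by
  rw [sub_single_liftEnv, sub_sub]; congr 1; funext A v
  cases v <;> rfl

theorem sub_single_zero_ren (t : CTm (B :: Γ) o) :
    sub (single (var .zero)) (ren (liftRen Ren.succ B) t) = t := by
  rw [sub_ren]
  refine Eq.trans ?_ (sub_var t)
  congr 1; funext A v
  cases v <;> rfl

/-- A closed term of every type, for filling in a variable that does not occur. -/
def dummy (A : Ty ι) : CTm Γ (.ty A) := mvar [] A 0 nil

theorem shift_injective : Function.Injective (shift : CTm Γ o → CTm (B :: Γ) o) :=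
  Function.LeftInverse.injective (g := sub (single (dummy B))) (sub_single_shift _)

/-! ### Tuples as substitutions -/

/-- The component of a tuple at a variable. -/
def lookup : ∀ {Δ : Ctx ι}, CTm Γ (.cx Δ) → Env Δ Γ
  | _, cons a _, _, .zero => a
  | _, cons _ s, _, .succ v => lookup s _ v

/-- The tuple with given components. -/
def tab : ∀ {Δ : Ctx ι}, Env Δ Γ → CTm Γ (.cx Δ)
  | [], _ => nil
  | _ :: _, τ => cons (τ _ .zero) (tab fun _ v => τ _ (.succ v))

@[simp] theorem lookup_tab (τ : Env Δ Γ) : lookup (tab τ) = τ := by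
  funext A v
  induction v with
  | zero => rfl
  | succ _ ih => exact ih _

@[simp] theorem tab_lookup (s : CTm Γ (.cx Δ)) : tab (lookup s) = s := by
  induction Δ with
  | nil => cases s; rfl
  | cons A Δ ih => cases s with | cons a s => exact congrArg (cons a) (ih s)

theorem lookup_cons (a : CTm Γ (.ty A)) (s : CTm Γ (.cx Δ)) :
    lookup (cons a s) = consEnv a (lookup s) := by
  funext B v; cases v <;> rfl

theorem sub_tab (σ : Env Γ Θ) (τ : Env Δ Γ) : sub σ (tab τ) = tab fun _ v => sub σ (τ _ v) := by
  induction Δ with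
  | nil => rfl
  | cons A Δ ih => exact congrArg (cons _) (ih _)

theorem lookup_sub (σ : Env Γ Θ) (s : CTm Γ (.cx Δ)) :
    lookup (sub σ s) = fun _ v => sub σ (lookup s _ v) := by
  conv_lhs => rw [← tab_lookup s, sub_tab, lookup_tab]

theorem lookup_ren (ρ : Ren Γ Θ) (s : CTm Γ (.cx Δ)) :
    lookup (ren ρ s) = fun _ v => ren ρ (lookup s _ v) := by
  simp only [ren_eq_sub, lookup_sub]

end CTm

namespace CTm

open Lam (liftRen)

variable {ι : Type u} {Γ Δ : Ctx ι} {A B : Ty ι} {o : Obj ι}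

/-! ### Free variables and strengthening -/

/-- The predicate `P` below an abstraction; the bound variable satisfies it. -/
def liftPred (P : ∀ A, Var Γ A → Prop) (B : Ty ι) : ∀ A, Var (B :: Γ) A → Prop
  | _, .zero => True
  | _, .succ v => P _ v

/-- All free variables of a contextual term satisfy `P`. -/
def FreeVars : ∀ {Γ : Ctx ι} {o : Obj ι}, (∀ A, Var Γ A → Prop) → CTm Γ o → Prop
  | _, _, P, var v => P _ v
  | _, _, P, mvar _ _ _ s => FreeVars P s
  | _, _, P, app a b => FreeVars P a ∧ FreeVars P b
  | _, _, P, lam a => FreeVars (liftPred P _) a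
  | _, _, _, nil => True
  | _, _, P, cons a s => FreeVars P a ∧ FreeVars P s

theorem liftPred_liftRen (P : ∀ A, Var Δ A → Prop) (ρ : Ren Γ Δ) (B : Ty ι) :
    (fun A v => liftPred P B A (liftRen ρ B A v)) = liftPred (fun _ v => P _ (ρ _ v)) B := by
  funext A v; cases v <;> rfl

theorem freeVars_ren (P : ∀ A, Var Δ A → Prop) (ρ : Ren Γ Δ) (t : CTm Γ o) :
    FreeVars P (ren ρ t) ↔ FreeVars (fun _ v => P _ (ρ _ v)) t := by
  induction t generalizing Δ with
  | lam a ih => simp only [ren, FreeVars, ih, liftPred_liftRen]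
  | _ => simp only [ren, FreeVars, *]

theorem freeVars_liftPred_liftEnv (P : ∀ A, Var Δ A → Prop) (τ : Env Γ Δ) (B : Ty ι) :
    (fun A v => FreeVars (liftPred P B) (liftEnv τ B A v)) =
      liftPred (fun _ v => FreeVars P (τ _ v)) B := by
  funext A v
  cases v with
  | zero => rfl
  | succ v => exact propext (freeVars_ren _ _ _)

theorem freeVars_sub (P : ∀ A, Var Δ A → Prop) (τ : Env Γ Δ) (t : CTm Γ o) :
    FreeVars P (sub τ t) ↔ FreeVars (fun _ v => FreeVars P (τ _ v)) t := by
  induction t generalizing Δ with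
  | lam a ih => simp only [sub, FreeVars, ih, freeVars_liftPred_liftEnv]
  | _ => simp only [sub, FreeVars, *]

theorem liftPred_mono {P Q : ∀ A, Var Γ A → Prop} (h : ∀ A v, P A v → Q A v) :
    ∀ A v, liftPred P B A v → liftPred Q B A v
  | _, .zero, _ => trivial
  | _, .succ v, hv => h _ v hv

theorem FreeVars.mono {P Q : ∀ A, Var Γ A → Prop} (h : ∀ A v, P A v → Q A v) {t : CTm Γ o}
    (ht : FreeVars P t) : FreeVars Q t := by
  induction t with
  | var v => exact h _ _ ht
  | mvar _ _ _ s ih => exact ih h ht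
  | app a b iha ihb => exact ⟨iha h ht.1, ihb h ht.2⟩
  | lam a ih => exact ih (liftPred_mono h) ht
  | nil => trivial
  | cons a s iha ihs => exact ⟨iha h ht.1, ihs h ht.2⟩

theorem freeVars_of_forall {P : ∀ A, Var Γ A → Prop} (h : ∀ A v, P A v) (t : CTm Γ o) :
    FreeVars P t := by
  induction t with
  | var v => exact h _ _
  | mvar _ _ _ _ ih => exact ih h
  | app _ _ iha ihb => exact ⟨iha h, ihb h⟩
  | lam _ ih => exact ih fun | _, .zero => trivial | _, .succ v => h _ v
  | nil => trivial
  | cons _ _ iha ihs => exact ⟨iha h, ihs h⟩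

theorem liftPred_range (ρ : Ren Γ Δ) :
    ∀ A v, liftPred (fun A v => ∃ w, ρ A w = v) B A v → ∃ w, liftRen ρ B A w = v
  | _, .zero, _ => ⟨.zero, rfl⟩
  | _, .succ _, hv => hv.imp' Var.succ fun _ => congrArg Var.succ

theorem exists_ren_eq_of_freeVars (ρ : Ren Γ Δ) (t : CTm Δ o)
    (h : FreeVars (fun A v => ∃ w, ρ A w = v) t) : ∃ t', ren ρ t' = t := by
  induction t generalizing Γ with
  | var v => obtain ⟨w, rfl⟩ := h; exact ⟨var w, rfl⟩
  | mvar Θ A n s ih => obtain ⟨s', rfl⟩ := ih ρ h; exact ⟨mvar Θ A n s', rfl⟩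
  | app a b iha ihb =>
    obtain ⟨a', rfl⟩ := iha ρ h.1
    obtain ⟨b', rfl⟩ := ihb ρ h.2
    exact ⟨app a' b', rfl⟩
  | lam a ih =>
    obtain ⟨a', rfl⟩ := ih (liftRen ρ _) (h.mono (liftPred_range ρ))
    exact ⟨lam a', rfl⟩
  | nil => exact ⟨nil, rfl⟩
  | cons a s iha ihs =>
    obtain ⟨a', rfl⟩ := iha ρ h.1
    obtain ⟨s', rfl⟩ := ihs ρ h.2
    exact ⟨cons a' s', rfl⟩

theorem exists_shift_of_sub_liftEnv {τ : Env Γ Δ} {t : CTm (B :: Γ) o} {c : CTm Δ o}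
    (h : sub (liftEnv τ B) t = shift c) : ∃ t', t = shift t' ∧ sub τ t' = c := by
  have hsub : FreeVars (fun A v => ∃ w, Ren.succ A w = v) (sub (liftEnv τ B) t) := by
    rw [h, freeVars_ren]; exact freeVars_of_forall (fun _ v => ⟨v, rfl⟩) _
  have ht : FreeVars (fun A v => ∃ w, Ren.succ A w = v) t := by
    refine ((freeVars_sub _ _ _).1 hsub).mono fun A v hv => ?_
    cases v with
    | zero => obtain ⟨w, hw⟩ := hv; cases hw
    | succ v => exact ⟨v, rfl⟩
  obtain ⟨t', rfl⟩ := exists_ren_eq_of_freeVars Ren.succ t ht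
  exact ⟨t', rfl, shift_injective (B := B) ((sub_liftEnv_shift τ t').symm.trans h)⟩

/-! ### βη-reduction -/

/-- One step of βη-reduction of contextual terms and tuples. The rule `eta` has an equation as its
premise, so that case analysis on a step never unifies against `shift a`. -/
inductive Step : ∀ {Γ : Ctx ι} {o : Obj ι}, CTm Γ o → CTm Γ o → Prop
  | beta {Γ : Ctx ι} {A B : Ty ι} (a : CTm (A :: Γ) (.ty B)) (b : CTm Γ (.ty A)) :
      Step (app (lam a) b) (sub (single b) a)
  | eta {Γ : Ctx ι} {A B : Ty ι} {p : CTm (A :: Γ) (.ty (.arrow A B))}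
      {a : CTm Γ (.ty (.arrow A B))} : p = shift a → Step (lam (app p (var .zero))) a
  | mvar {Γ : Ctx ι} (Δ : Ctx ι) (A : Ty ι) (n : ℕ) {s s' : CTm Γ (.cx Δ)} :
      Step s s' → Step (mvar Δ A n s) (mvar Δ A n s')
  | appL {Γ : Ctx ι} {A B : Ty ι} {a a' : CTm Γ (.ty (.arrow A B))} (b : CTm Γ (.ty A)) :
      Step a a' → Step (app a b) (app a' b)
  | appR {Γ : Ctx ι} {A B : Ty ι} (a : CTm Γ (.ty (.arrow A B))) {b b' : CTm Γ (.ty A)} :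
      Step b b' → Step (app a b) (app a b')
  | lam {Γ : Ctx ι} {A B : Ty ι} {a a' : CTm (A :: Γ) (.ty B)} :
      Step a a' → Step (lam a) (lam a')
  | consL {Γ Δ : Ctx ι} {A : Ty ι} {a a' : CTm Γ (.ty A)} (s : CTm Γ (.cx Δ)) :
      Step a a' → Step (cons a s) (cons a' s)
  | consR {Γ Δ : Ctx ι} {A : Ty ι} (a : CTm Γ (.ty A)) {s s' : CTm Γ (.cx Δ)} :
      Step s s' → Step (cons a s) (cons a s')

/-- βη-reduction in any number of steps. -/
abbrev Steps : CTm Γ o → CTm Γ o → Prop := ReflTransGen Step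

/-- Irreducibility for βη-reduction. -/
def Irred (t : CTm Γ o) : Prop := ∀ t', ¬ Step t t'

namespace Step

theorem sub {t t' : CTm Γ o} (h : Step t t') (τ : Env Γ Δ) :
    Step (CTm.sub τ t) (CTm.sub τ t') := by
  induction h generalizing Δ with
  | beta a b => rw [sub_sub_single]; exact .beta _ _
  | eta hp => subst hp; exact .eta (sub_liftEnv_shift _ _)
  | mvar _ _ _ _ ih => exact .mvar _ _ _ (ih τ)
  | appL _ _ ih => exact .appL _ (ih τ)
  | appR _ _ ih => exact .appR _ (ih τ)
  | lam _ ih => exact .lam (ih _)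
  | consL _ _ ih => exact .consL _ (ih τ)
  | consR _ _ ih => exact .consR _ (ih τ)

theorem ren {t t' : CTm Γ o} (h : Step t t') (ρ : Ren Γ Δ) :
    Step (CTm.ren ρ t) (CTm.ren ρ t') := by
  rw [ren_eq_sub, ren_eq_sub]; exact h.sub _

theorem lookup {s s' : CTm Γ (.cx Δ)} (h : Step s s') (v : Var Δ A) :
    lookup s A v = lookup s' A v ∨ Step (lookup s A v) (lookup s' A v) := by
  induction v with
  | zero =>
    cases h with
    | consL _ h => exact .inr h
    | consR _ _ => exact .inl rfl
  | succ _ ih =>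
    cases h with
    | consL _ _ => exact .inl rfl
    | consR _ h => exact ih h

end Step

namespace Steps

theorem mvar (Δ : Ctx ι) (A : Ty ι) (n : ℕ) {s s' : CTm Γ (.cx Δ)} (h : Steps s s') :
    Steps (mvar Δ A n s) (mvar Δ A n s') :=
  ReflTransGen.lift _ (fun _ _ => .mvar _ _ _) _ _ h

theorem app {a a' : CTm Γ (.ty (.arrow A B))} {b b' : CTm Γ (.ty A)} (ha : Steps a a')
    (hb : Steps b b') : Steps (app a b) (app a' b') :=
  (ReflTransGen.lift (CTm.app · b) (fun _ _ => .appL _) _ _ ha).trans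
    (ReflTransGen.lift (CTm.app a') (fun _ _ => .appR _) _ _ hb)

theorem lam {a a' : CTm (A :: Γ) (.ty B)} (h : Steps a a') : Steps (lam a) (lam a') :=
  ReflTransGen.lift _ (fun _ _ => .lam) _ _ h

theorem cons {a a' : CTm Γ (.ty A)} {s s' : CTm Γ (.cx Δ)} (ha : Steps a a')
    (hs : Steps s s') : Steps (cons a s) (cons a' s') :=
  (ReflTransGen.lift (CTm.cons · s) (fun _ _ => .consL _) _ _ ha).trans
    (ReflTransGen.lift (CTm.cons a') (fun _ _ => .consR _) _ _ hs)

theorem sub {t t' : CTm Γ o} (h : Steps t t') (τ : Env Γ Δ) :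
    Steps (CTm.sub τ t) (CTm.sub τ t') :=
  ReflTransGen.lift _ (fun _ _ h => h.sub τ) _ _ h

theorem ren {t t' : CTm Γ o} (h : Steps t t') (ρ : Ren Γ Δ) :
    Steps (CTm.ren ρ t) (CTm.ren ρ t') :=
  ReflTransGen.lift _ (fun _ _ h => h.ren ρ) _ _ h

theorem liftEnv {τ τ' : Env Γ Δ} (h : ∀ A v, Steps (τ A v) (τ' A v)) (B : Ty ι) :
    ∀ A v, Steps (CTm.liftEnv τ B A v) (CTm.liftEnv τ' B A v)
  | _, .zero => .refl
  | _, .succ v => (h _ v).ren _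

theorem sub_env (t : CTm Γ o) {τ τ' : Env Γ Δ} (h : ∀ A v, Steps (τ A v) (τ' A v)) :
    Steps (CTm.sub τ t) (CTm.sub τ' t) := by
  induction t generalizing Δ with
  | var v => exact h _ _
  | mvar _ _ _ s ih => exact mvar _ _ _ (ih h)
  | app a b iha ihb => exact app (iha h) (ihb h)
  | lam a ih => exact lam (ih (liftEnv h _))
  | nil => exact .refl
  | cons a s iha ihs => exact cons (iha h) (ihs h)

theorem lookup {s s' : CTm Γ (.cx Δ)} (h : Steps s s') (A : Ty ι) (v : Var Δ A) :
    Steps (lookup s A v) (lookup s' A v) := by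
  induction h with
  | refl => exact .refl
  | tail _ h ih =>
    rcases h.lookup v with h | h
    · rwa [← h]
    · exact ih.tail h

end Steps

/-! ### Strong normalization -/

/-- Strong normalization: there is no infinite sequence of steps from `t`. -/
abbrev SN (t : CTm Γ o) : Prop := Acc (fun a b => Step b a) t

/-- Reducibility in the sense of Tait. -/
def Red : ∀ A : Ty ι, CTm Γ (.ty A) → Prop
  | .base _, t => SN t
  | .arrow A B, t => ∀ u, Red A u → Red B (app t u)

/-- Being an abstraction. The other terms are neutral for the reducibility method: applying them
creates no redex. -/
def IsLam : CTm Γ o → Prop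
  | lam _ => True
  | _ => False

theorem irred_var (v : Var Γ A) : Irred (var v) := nofun

theorem irred_dummy (A : Ty ι) : Irred (dummy A : CTm Γ (.ty A)) := by
  intro t h
  cases h with
  | mvar _ _ _ h => cases h

theorem SN.of_sub {t : CTm Γ o} (τ : Env Γ Δ) (h : SN (sub τ t)) : SN t :=
  Subrelation.accessible (fun h => h.sub τ) (InvImage.accessible (sub τ) h)

theorem SN.of_app {t : CTm Γ (.ty (.arrow A B))} {b : CTm Γ (.ty A)} (h : SN (app t b)) : SN t :=
  Subrelation.accessible (Step.appL b) (InvImage.accessible (app · b) h)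

theorem SN.cons {a : CTm Γ (.ty A)} {s : CTm Γ (.cx Δ)} (ha : SN a) (hs : SN s) :
    SN (cons a s) := by
  induction ha generalizing s with
  | intro a _ iha =>
    induction hs with
    | intro s hs ihs =>
      refine ⟨_, fun t h => ?_⟩
      cases h with
      | consL _ h => exact iha _ h ⟨_, hs⟩
      | consR _ h => exact ihs _ h

/-- Girard's conditions on a set of terms of type `A`: the elements are strongly normalizing, the
set is closed under steps, and it contains a neutral term as soon as it contains its reducts. -/
structure IsCandidate (R : ∀ {Γ : Ctx ι}, CTm Γ (.ty A) → Prop) : Prop where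
  sn {Γ : Ctx ι} {t : CTm Γ (.ty A)} : R t → SN t
  step {Γ : Ctx ι} {t t' : CTm Γ (.ty A)} : R t → Step t t' → R t'
  of_neutral {Γ : Ctx ι} {t : CTm Γ (.ty A)} : ¬ IsLam t → (∀ t', Step t t' → R t') → R t

theorem isCandidate_red (A : Ty ι) : IsCandidate (Red A) := by
  induction A with
  | base i => exact ⟨id, Acc.inv, fun _ h => ⟨_, h⟩⟩
  | arrow A B ihA ihB =>
    refine ⟨fun {Γ} t ht => ?_, fun ht h u hu => ihB.step (ht u hu) (.appL u h),
      fun {Γ} t ht h u hu => ?_⟩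
    · have hdummy : Red A (dummy A : CTm Γ _) :=
        ihA.of_neutral id fun t' h => (irred_dummy A t' h).elim
      exact (ihB.sn (ht _ hdummy)).of_app
    · induction ihA.sn hu with
      | intro u _ ih =>
        refine ihB.of_neutral id fun t' h' => ?_
        cases h' with
        | beta => exact (ht trivial).elim
        | appL _ h' => exact h _ h' _ hu
        | appR _ h' => exact ih _ h' (ihA.step hu h')

namespace Red

theorem sn {t : CTm Γ (.ty A)} (h : Red A t) : SN t := (isCandidate_red A).sn h

theorem step {t t' : CTm Γ (.ty A)} (h : Red A t) (h' : Step t t') : Red A t' :=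
  (isCandidate_red A).step h h'

theorem of_neutral {t : CTm Γ (.ty A)} (ht : ¬ IsLam t) (h : ∀ t', Step t t' → Red A t') :
    Red A t :=
  (isCandidate_red A).of_neutral ht h

theorem var (v : Var Γ A) : Red A (var v) :=
  .of_neutral id fun _ h => (irred_var v _ h).elim

theorem dummy (A : Ty ι) : Red A (dummy A : CTm Γ (.ty A)) :=
  .of_neutral id fun _ h => (irred_dummy A _ h).elim

theorem mvar (Δ : Ctx ι) (A : Ty ι) (n : ℕ) {s : CTm Γ (.cx Δ)} (h : SN s) :
    Red A (mvar Δ A n s) := by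
  induction h with
  | intro s _ ih =>
    refine .of_neutral id fun t h => ?_
    cases h with
    | mvar _ _ _ h => exact ih _ h

theorem lam {a : CTm (A :: Γ) (.ty B)} (h : ∀ u, Red A u → Red B (sub (single u) a)) :
    Red (.arrow A B) (lam a) := by
  intro u hu
  have ha : SN a := (h _ (Red.dummy A)).sn.of_sub
  have hsn := hu.sn
  induction ha generalizing u with
  | intro a _ iha =>
    induction hsn with
    | intro u hu' ihu =>
      refine .of_neutral id fun t ht => ?_
      cases ht with
      | beta => exact h u hu
      | appL _ ht =>
        cases ht with
        | eta hp =>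
          have hred := h u hu
          rwa [hp, CTm.sub, sub_single_shift] at hred
        | lam ht => exact iha _ ht (fun u hu => (h u hu).step (ht.sub _)) u hu ⟨_, hu'⟩
      | appR _ ht => exact ihu _ ht (hu.step ht)

end Red

/-- The induction hypothesis for strong normalization: reducibility for terms, strong
normalization for tuples. -/
def RedObj : ∀ {o : Obj ι}, CTm Γ o → Prop
  | .ty A, t => Red A t
  | .cx _, s => SN s

theorem redObj_sub (t : CTm Γ o) (τ : Env Γ Δ) (h : ∀ A v, Red A (τ A v)) :
    RedObj (sub τ t) := by
  induction t generalizing Δ with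
  | var v => exact h _ _
  | mvar _ _ _ _ ih => exact Red.mvar _ _ _ (ih τ h)
  | app _ _ iha ihb => exact iha τ h _ (ihb τ h)
  | lam _ ih =>
    refine Red.lam fun u hu => ?_
    rw [sub_single_liftEnv]
    exact ih _ fun | _, .zero => hu | _, .succ v => h _ v
  | nil => exact ⟨_, nofun⟩
  | cons _ _ iha ihs => exact SN.cons (Red.sn (iha τ h)) (ihs τ h)

theorem strong_normalization (t : CTm Γ o) : SN t := by
  have h := redObj_sub t _ fun _ v => Red.var v
  rw [sub_var] at h
  cases o with
  | ty A => exact Red.sn h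
  | cx Δ => exact h

theorem exists_irred (t : CTm Γ o) : ∃ t', Steps t t' ∧ Irred t' := by
  induction strong_normalization t with
  | intro t _ ih =>
    by_cases h : ∃ t', Step t t'
    · obtain ⟨t', h⟩ := h
      obtain ⟨t'', hsteps, hirred⟩ := ih t' h
      exact ⟨t'', .head h hsteps, hirred⟩
    · exact ⟨t, .refl, not_exists.1 h⟩

theorem Step.ne {t t' : CTm Γ o} (h : Step t t') : t ≠ t' := by
  rintro rfl
  induction strong_normalization t with
  | intro t _ ih => exact ih t h h

end CTm

/-! ### Confluence -/

-- Newman's lemma.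
theorem join_of_acc_of_locally_confluent {α : Type*} {r : α → α → Prop} {x y z : α}
    (hx : Acc (fun a b => r b a) x)
    (hr : ∀ ⦃a b c⦄, r a b → r a c → Relation.Join (ReflTransGen r) b c)
    (hy : ReflTransGen r x y) (hz : ReflTransGen r x z) : Relation.Join (ReflTransGen r) y z := by
  induction hx generalizing y z with
  | intro x _ ih =>
    rcases hy.cases_head with rfl | ⟨y', hxy', hy'y⟩
    · exact ⟨z, hz, .refl⟩
    rcases hz.cases_head with rfl | ⟨z', hxz', hz'z⟩
    · exact ⟨y, .refl, hy⟩
    obtain ⟨w, hy'w, hz'w⟩ := hr hxy' hxz'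
    obtain ⟨v, hyv, hwv⟩ := ih _ hxy' hy'y hy'w
    obtain ⟨u, hzu, hvu⟩ := ih _ hxz' hz'z (hz'w.trans hwv)
    exact ⟨u, hyv.trans hvu, hzu⟩

namespace CTm

open Lam (liftRen)

variable {ι : Type u} {Γ Δ : Ctx ι} {A B : Ty ι} {o : Obj ι}

/-- Having a common βη-reduct. -/
abbrev Join (t t' : CTm Γ o) : Prop := Relation.Join Steps t t'

theorem Join.of_eq {t t' : CTm Γ o} (h : t = t') : Join t t' := ⟨t, .refl, h ▸ .refl⟩

theorem Join.map {o' : Obj ι} {t t' : CTm Γ o} (f : CTm Γ o → CTm Δ o')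
    (hf : ∀ x y, Step x y → Step (f x) (f y)) : Join t t' → Join (f t) (f t')
  | ⟨x, hx, hx'⟩ => ⟨f x, ReflTransGen.lift f hf _ _ hx, ReflTransGen.lift f hf _ _ hx'⟩

theorem Join.symm {t t' : CTm Γ o} (h : Join t t') : Join t' t :=
  Relation.Join.symm.symm _ _ h

theorem exists_of_ren_eq_var {ρ : Ren Γ Δ} {t : CTm Γ (.ty A)} {w : Var Δ A}
    (h : ren ρ t = var w) : ∃ x, t = var x ∧ ρ A x = w := by
  cases t with
  | var x => cases h; exact ⟨x, rfl, rfl⟩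
  | _ => cases h

theorem exists_of_ren_eq_lam {ρ : Ren Γ Δ} {t : CTm Γ (.ty (.arrow A B))}
    {a' : CTm (A :: Δ) (.ty B)} (h : ren ρ t = lam a') :
    ∃ a, t = lam a ∧ ren (liftRen ρ A) a = a' := by
  cases t with
  | lam a => cases h; exact ⟨a, rfl, rfl⟩
  | _ => cases h

theorem shift_ne_zero (t : CTm Γ (.ty A)) : shift t ≠ var (.zero : Var (A :: Γ) A) := by
  intro h
  cases t <;> cases h

theorem shift_ne_app_zero (t : CTm Γ (.ty B)) (p : CTm (A :: Γ) (.ty (.arrow A B))) :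
    shift t ≠ app p (var .zero) := by
  intro h
  cases t with
  | app q r =>
    simp only [shift, ren, app.injEq] at h
    obtain ⟨rfl, -, hr⟩ := h
    exact shift_ne_zero r (eq_of_heq hr)
  | _ => cases h

theorem exists_of_sub_liftEnv_eq_app_zero {τ : Env Γ Δ} {t : CTm (A :: Γ) (.ty B)}
    {p' : CTm (A :: Δ) (.ty (.arrow A B))} (h : sub (liftEnv τ A) t = app p' (var .zero)) :
    ∃ p, t = app p (var .zero) ∧ sub (liftEnv τ A) p = p' := by
  cases t with
  | var v =>
    cases v with
    | zero => cases h
    | succ v => exact (shift_ne_app_zero _ _ h).elim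
  | app p q =>
    simp only [sub, app.injEq] at h
    obtain ⟨rfl, hp, hq⟩ := h
    cases q with
    | var v =>
      cases v with
      | zero => exact ⟨p, rfl, eq_of_heq hp⟩
      | succ v => exact (shift_ne_zero _ (eq_of_heq hq)).elim
    | _ => cases hq
  | _ => cases h

theorem exists_of_step_ren (ρ : Ren Γ Δ) (t : CTm Γ o) {c : CTm Δ o} (h : Step (ren ρ t) c) :
    ∃ t', c = ren ρ t' ∧ Step t t' := by
  induction t generalizing Δ with
  | var v => cases h
  | mvar Θ A n s ih =>
    cases h with
    | mvar _ _ _ h => obtain ⟨s', rfl, h'⟩ := ih ρ h; exact ⟨_, rfl, .mvar _ _ _ h'⟩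
  | app a b iha ihb =>
    simp only [ren] at h
    generalize ha : ren ρ a = a₁ at h
    cases h with
    | beta a' _ =>
      obtain ⟨a, rfl, rfl⟩ := exists_of_ren_eq_lam ha
      exact ⟨_, by simp only [ren_eq_sub, sub_sub_single, liftEnv_var_comp], .beta a b⟩
    | appL _ h => subst ha; obtain ⟨a', rfl, h'⟩ := iha ρ h; exact ⟨_, rfl, .appL _ h'⟩
    | appR _ h => subst ha; obtain ⟨b', rfl, h'⟩ := ihb ρ h; exact ⟨_, rfl, .appR _ h'⟩
  | lam a ih =>
    simp only [ren] at h
    generalize ha : ren (liftRen ρ _) a = a₁ at h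
    cases h with
    | eta hp =>
      rw [ren_eq_sub, ← liftEnv_var_comp] at ha
      obtain ⟨p, rfl, rfl⟩ := exists_of_sub_liftEnv_eq_app_zero ha
      obtain ⟨p', rfl, rfl⟩ := exists_shift_of_sub_liftEnv hp
      exact ⟨p', (ren_eq_sub _ _).symm, .eta rfl⟩
    | lam h => subst ha; obtain ⟨a', rfl, h'⟩ := ih _ h; exact ⟨_, rfl, .lam h'⟩
  | nil => cases h
  | cons a s iha ihs =>
    cases h with
    | consL _ h => obtain ⟨a', rfl, h'⟩ := iha ρ h; exact ⟨_, rfl, .consL _ h'⟩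
    | consR _ h => obtain ⟨s', rfl, h'⟩ := ihs ρ h; exact ⟨_, rfl, .consR _ h'⟩

theorem join_beta {a : CTm (A :: Γ) (.ty B)} {b : CTm Γ (.ty A)} {t : CTm Γ (.ty B)}
    (h : Step (app (lam a) b) t) : Join (sub (single b) a) t := by
  cases h with
  | beta => exact .of_eq rfl
  | appL _ h =>
    cases h with
    | eta hp => subst hp; exact .of_eq (congrArg (app · b) (sub_single_shift b _))
    | lam h => exact ⟨_, .single (h.sub _), .single (.beta _ _)⟩
  | appR _ h =>
    refine ⟨_, Steps.sub_env a fun C v => ?_, .single (.beta _ _)⟩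
    cases v with
    | zero => exact .single h
    | succ v => exact .refl

theorem join_eta {a t : CTm Γ (.ty (.arrow A B))}
    (h : Step (lam (app (shift a) (var .zero))) t) : Join a t := by
  generalize ha : shift a = p at h
  cases h with
  | eta hp => exact .of_eq (shift_injective (ha.trans hp))
  | lam h =>
    cases h with
    | beta a' _ =>
      obtain ⟨a, rfl, rfl⟩ := exists_of_ren_eq_lam ha
      exact .of_eq (by rw [sub_single_zero_ren])
    | appL _ h =>
      subst ha
      obtain ⟨a', rfl, h'⟩ := exists_of_step_ren _ _ h
      exact ⟨_, .single h', .single (.eta rfl)⟩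
    | appR _ h => cases h

theorem local_confluence {t t₁ t₂ : CTm Γ o} (h₁ : Step t t₁) (h₂ : Step t t₂) :
    Join t₁ t₂ := by
  induction h₁ with
  | beta a b => exact join_beta h₂
  | eta hp => subst hp; exact join_eta h₂
  | mvar _ _ _ _ ih =>
    cases h₂ with
    | mvar _ _ _ h' => exact (ih h').map _ fun _ _ => .mvar _ _ _
  | appL b h ih =>
    cases h₂ with
    | beta => exact (join_beta (.appL _ h)).symm
    | appL _ h' => exact (ih h').map (app · b) fun _ _ => .appL _
    | appR _ h' => exact ⟨_, .single (.appR _ h'), .single (.appL _ h)⟩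
  | appR a h ih =>
    cases h₂ with
    | beta => exact (join_beta (.appR _ h)).symm
    | appL _ h' => exact ⟨_, .single (.appL _ h'), .single (.appR _ h)⟩
    | appR _ h' => exact (ih h').map (app a) fun _ _ => .appR _
  | lam h ih =>
    cases h₂ with
    | eta hp => subst hp; exact (join_eta (.lam h)).symm
    | lam h' => exact (ih h').map lam fun _ _ => .lam
  | consL s h ih =>
    cases h₂ with
    | consL _ h' => exact (ih h').map (cons · s) fun _ _ => .consL _
    | consR _ h' => exact ⟨_, .single (.consR _ h'), .single (.consL _ h)⟩
  | consR a h ih =>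
    cases h₂ with
    | consL _ h' => exact ⟨_, .single (.consL _ h'), .single (.consR _ h)⟩
    | consR _ h' => exact (ih h').map (cons a) fun _ _ => .consR _

theorem confluence {t t₁ t₂ : CTm Γ o} (h₁ : Steps t t₁) (h₂ : Steps t t₂) : Join t₁ t₂ :=
  join_of_acc_of_locally_confluent (strong_normalization t) (fun _ _ _ => local_confluence) h₁ h₂

theorem equivalence_join (Γ : Ctx ι) (o : Obj ι) :
    Equivalence (Join : CTm Γ o → CTm Γ o → Prop) :=
  Relation.equivalence_join fun _ _ _ => confluence

theorem Irred.eq_of_steps {t t' : CTm Γ o} (h : Irred t) (h' : Steps t t') : t = t' := by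
  rcases h'.cases_head with h' | ⟨u, hu, _⟩
  · exact h'
  · exact (h _ hu).elim

theorem Irred.eq_of_join {t t' : CTm Γ o} (h : Irred t) (h' : Irred t') :
    Join t t' → t = t'
  | ⟨_, hx, hx'⟩ => (h.eq_of_steps hx).trans (h'.eq_of_steps hx').symm

end CTm

/-! ### Evaluation of λσ-expressions to contextual terms -/

/-- The context over which an expression is defined. -/
abbrev Kind.dom {ι : Type u} : Kind ι → Ctx ι
  | .tm Γ _ => Γ
  | .sb Γ _ => Γ

/-- The classifier of an expression. -/
abbrev Kind.obj {ι : Type u} : Kind ι → Obj ι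
  | .tm _ A => .ty A
  | .sb _ Δ => .cx Δ

/-- The kind of the expressions over `Γ` with a given classifier. -/
abbrev Obj.kind {ι : Type u} : Obj ι → Ctx ι → Kind ι
  | .ty A, Γ => .tm Γ A
  | .cx Δ, Γ => .sb Γ Δ

namespace Exp

variable {ι : Type u}

/-- The contextual term denoted by an expression; substitutions denote tuples. -/
def eval : ∀ {k : Kind ι}, Exp k → CTm k.dom k.obj
  | _, one => .var .zero
  | _, mvar Γ A n => .mvar Γ A n (.tab fun _ v => .var v)
  | _, app a b => .app (eval a) (eval b)
  | _, lam a => .lam (eval a)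
  | _, clos a s => CTm.sub (CTm.lookup (eval s)) (eval a)
  | _, id => .tab fun _ v => .var v
  | _, shift => .tab fun _ v => .var (.succ v)
  | _, cons a s => .cons (eval a) (eval s)
  | .sb Γ Θ, comp (Δ := Δ) s t =>
    CTm.sub (Γ := Δ) (Δ := Γ) (CTm.lookup (eval t)) (eval s : CTm Δ (.cx Θ))

variable {Γ Δ Θ : Ctx ι} {A B : Ty ι} {k : Kind ι} {e e' : Exp k}

open CTm in
theorem SigmaRule.eval_eq (h : SigmaRule e e') : eval e = eval e' := by
  cases h with
  | app | map | varCons | varShift => rfl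
  | abs a s =>
    simp only [eval, CTm.sub, lookup_cons, lookup_tab, ← ren_eq_sub, lookup_ren]; rfl
  | clos | assoc => simp only [eval, CTm.sub_sub, lookup_sub]
  | id | idR => simp only [eval, lookup_tab, sub_var]
  | idL => simp only [eval, sub_tab, CTm.sub, tab_lookup]
  | shiftCons => simp only [eval, sub_tab, CTm.sub, lookup_cons, consEnv, tab_lookup]
  | sCons s =>
    simp only [eval, sub_tab, CTm.sub]
    exact tab_lookup (eval s)

theorem SigmaStep.eval_eq (h : SigmaStep e e') : eval e = eval e' := by
  induction h with
  | root h => exact h.eval_eq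
  | _ => simp only [eval, *]

theorem SigmaConv.eval_eq (h : SigmaConv e e') : eval e = eval e' := by
  induction h with
  | rel _ _ h => exact h.eval_eq
  | refl => rfl
  | symm _ _ _ ih => exact ih.symm
  | trans _ _ _ _ _ ih ih' => exact ih.trans ih'

theorem eval_clos_shift (a : Exp (.tm Γ A)) :
    eval (clos a (shift : Exp (.sb (B :: Γ) Γ))) = CTm.shift (eval a) := by
  simp only [eval, CTm.lookup_tab, ← CTm.ren_eq_sub]

theorem LambdaSigmaRule.eval_steps (h : LambdaSigmaRule e e') : CTm.Steps (eval e) (eval e') := by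
  cases h with
  | sigma h => rw [h.eval_eq]
  | beta a b =>
    simp only [eval, CTm.lookup_cons, CTm.lookup_tab]
    exact .single (.beta _ _)
  | eta a b h => exact .single (.eta (by rw [h.eval_eq, eval_clos_shift]))

theorem LambdaSigmaStep.eval_steps (h : LambdaSigmaStep e e') : CTm.Steps (eval e) (eval e') := by
  induction h with
  | root h => exact h.eval_steps
  | appL _ _ ih => exact ih.app .refl
  | appR _ _ ih => exact CTm.Steps.app .refl ih
  | lam _ ih => exact ih.lam
  | closL _ _ ih => exact ih.sub _
  | closR _ _ ih => exact CTm.Steps.sub_env _ ih.lookup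
  | consL _ _ ih => exact ih.cons .refl
  | consR _ _ ih => exact CTm.Steps.cons .refl ih
  | compL _ _ ih => exact ih.sub _
  | compR _ _ ih => exact CTm.Steps.sub_env _ ih.lookup

theorem eval_steps (h : ReflTransGen LambdaSigmaStep e e') : CTm.Steps (eval e) (eval e') :=
  ReflTransGen.lift' eval (fun _ _ => LambdaSigmaStep.eval_steps) _ _ h

/-! ### Reduction in any number of steps -/

/-- Reduction in any number of steps for the system with the root rules `R`. -/
def CSteps (R : ∀ {k : Kind ι}, Exp k → Exp k → Prop) (e e' : Exp k) : Prop :=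
  ReflTransGen (Compat R) e e'

namespace CSteps

variable {R : ∀ {k : Kind ι}, Exp k → Exp k → Prop}

theorem refl (e : Exp k) : CSteps R e e := ReflTransGen.refl

theorem trans {e₁ e₂ e₃ : Exp k} (h : CSteps R e₁ e₂) (h' : CSteps R e₂ e₃) :
    CSteps R e₁ e₃ := ReflTransGen.trans h h'

theorem root (h : R e e') : CSteps R e e' := ReflTransGen.single (.root h)

theorem app {a a' : Exp (.tm Γ (.arrow A B))} {b b' : Exp (.tm Γ A)} (ha : CSteps R a a')
    (hb : CSteps R b b') : CSteps R (app a b) (app a' b') :=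
  trans (ReflTransGen.lift (Exp.app · b) (fun _ _ => .appL _) _ _ ha)
    (ReflTransGen.lift (Exp.app a') (fun _ _ => .appR _) _ _ hb)

theorem lam {a a' : Exp (.tm (A :: Γ) B)} (h : CSteps R a a') : CSteps R (lam a) (lam a') :=
  ReflTransGen.lift _ (fun _ _ => .lam) _ _ h

theorem clos {a a' : Exp (.tm Δ A)} {s s' : Exp (.sb Γ Δ)} (ha : CSteps R a a')
    (hs : CSteps R s s') : CSteps R (clos a s) (clos a' s') :=
  trans (ReflTransGen.lift (Exp.clos · s) (fun _ _ => .closL _) _ _ ha)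
    (ReflTransGen.lift (Exp.clos a') (fun _ _ => .closR _) _ _ hs)

theorem cons {a a' : Exp (.tm Γ A)} {s s' : Exp (.sb Γ Δ)} (ha : CSteps R a a')
    (hs : CSteps R s s') : CSteps R (cons a s) (cons a' s') :=
  trans (ReflTransGen.lift (Exp.cons · s) (fun _ _ => .consL _) _ _ ha)
    (ReflTransGen.lift (Exp.cons a') (fun _ _ => .consR _) _ _ hs)

theorem comp {s s' : Exp (.sb Δ Θ)} {t t' : Exp (.sb Γ Δ)} (hs : CSteps R s s')
    (ht : CSteps R t t') : CSteps R (comp s t) (comp s' t') :=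
  trans (ReflTransGen.lift (Exp.comp · t) (fun _ _ => .compL _) _ _ hs)
    (ReflTransGen.lift (Exp.comp s') (fun _ _ => .compR _) _ _ ht)

end CSteps

/-- Reduction in `σ` in any number of steps. -/
abbrev SigmaSteps (e e' : Exp k) : Prop := CSteps SigmaRule e e'

/-- Reduction in `λσ` in any number of steps. -/
abbrev LambdaSigmaSteps (e e' : Exp k) : Prop := CSteps LambdaSigmaRule e e'

theorem Compat.mono {R S : ∀ {k : Kind ι}, Exp k → Exp k → Prop}
    (h : ∀ {k : Kind ι} (e e' : Exp k), R e e' → S e e') (he : Compat R e e') :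
    Compat S e e' := by
  induction he with
  | root h' => exact .root (h _ _ h')
  | appL _ _ ih => exact .appL _ ih
  | appR _ _ ih => exact .appR _ ih
  | lam _ ih => exact .lam ih
  | closL _ _ ih => exact .closL _ ih
  | closR _ _ ih => exact .closR _ ih
  | consL _ _ ih => exact .consL _ ih
  | consR _ _ ih => exact .consR _ ih
  | compL _ _ ih => exact .compL _ ih
  | compR _ _ ih => exact .compR _ ih

theorem CSteps.toLambdaSigma (h : SigmaSteps e e') : LambdaSigmaSteps e e' :=
  ReflTransGen.mono (fun _ _ => Compat.mono fun _ _ => .sigma) _ _ h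

theorem CSteps.sigmaConv (h : SigmaSteps e e') : SigmaConv e e' :=
  Relation.EqvGen.reflTransGen_le_eqvGen _ _ _ h

theorem CSteps.eval_eq (h : SigmaSteps e e') : eval e = eval e' := h.sigmaConv.eval_eq

/-! ### Reification: the σ-normal form denoting a contextual term -/

/-- Contraction of the expression itself, if it is a redex of `σ`. -/
noncomputable def contract (e : Exp k) : Exp k :=
  open Classical in if h : ∃ x, SigmaRule e x then h.choose else e

theorem contract_eq (h : SigmaRule e e') (unique : ∀ x, SigmaRule e x → x = e') :
    contract e = e' := by
  have reducible : ∃ x, SigmaRule e x := ⟨e', h⟩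
  rw [contract, dif_pos reducible]
  exact unique _ reducible.choose_spec

theorem contract_spec (e : Exp k) :
    SigmaRule e (contract e) ∨ (contract e = e ∧ ∀ x, ¬ SigmaRule e x) := by
  by_cases h : ∃ x, SigmaRule e x
  · rw [contract, dif_pos h]
    exact .inl h.choose_spec
  · exact .inr ⟨dif_neg h, not_exists.mp h⟩

theorem contract_eq_self (h : ∀ x, ¬ SigmaRule e x) : contract e = e :=
  dif_neg (not_exists.mpr h)

theorem steps_contract (e : Exp k) : SigmaSteps e (contract e) := by
  rcases contract_spec e with h | ⟨h, -⟩
  · exact .root h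
  · rw [h]
    exact .refl _

theorem eval_contract (e : Exp k) : eval (contract e) = eval e :=
  (steps_contract e).eval_eq.symm

end Exp

/-- `Wk Θ Γ`: the context `Γ` is obtained from `Θ` by dropping variables from the top. Unlike
`Depth`, it is built from the large context `Θ` downwards, which matches the normal form
`↑ ∘ (↑ ∘ ⋯)` of an iterated shift. -/
inductive Wk {ι : Type u} (Θ : Ctx ι) : Ctx ι → Type u
  | refl : Wk Θ Θ
  | drop {Γ : Ctx ι} {A : Ty ι} : Wk Θ (A :: Γ) → Wk Θ Γ

namespace Wk

variable {ι : Type u} {Θ Γ : Ctx ι}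

/-- The renaming given by a weakening. -/
def var {Θ : Ctx ι} : ∀ {Γ : Ctx ι}, Wk Θ Γ → Ren Γ Θ
  | _, refl, _, v => v
  | _, drop w, _, v => w.var _ (.succ v)

/-- The weakening of the empty context obtained from a given weakening by dropping the remaining
variables. -/
def toNil {Θ : Ctx ι} : ∀ {Γ : Ctx ι}, Wk Θ Γ → Wk Θ []
  | [], w => w
  | _ :: _, w => toNil (drop w)

theorem toNil_eq (w : Wk Θ Γ) : w.toNil = (refl : Wk Θ Θ).toNil := by
  induction w with
  | refl => rfl
  | drop _ ih => exact ih

end Wk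

namespace Exp

variable {ι : Type u} {Γ Δ Θ : Ctx ι} {A B : Ty ι} {o : Obj ι} {k : Kind ι} {e e' : Exp k}

/-- The normal form of `↑ ∘ s`, when `s` is the normal form of the shift given by a weakening. -/
def shiftComp : ∀ {Θ Γ : Ctx ι} {A : Ty ι}, Wk Θ (A :: Γ) → Exp (.sb Θ (A :: Γ)) → Exp (.sb Θ Γ)
  | _, _, _, .refl, _ => shift
  | _, _, _, .drop _, s => comp shift s

/-- The normal form of the shift given by a weakening. -/
def pow {Θ : Ctx ι} : ∀ {Γ : Ctx ι}, Wk Θ Γ → Exp (.sb Θ Γ)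
  | _, .refl => id
  | _, .drop w => shiftComp w (pow w)

theorem eval_pow (w : Wk Θ Γ) : eval (pow w) = .tab fun _ v => .var (w.var _ v) := by
  induction w with
  | refl => rfl
  | drop w ih =>
    cases w with
    | refl => rfl
    | drop w =>
      simp only [pow, shiftComp] at ih ⊢
      simp only [eval, ih, CTm.lookup_tab, CTm.sub_tab]
      rfl

/-- The normal form of a variable of a weakened context. -/
noncomputable def reifyVar {Θ : Ctx ι} {A : Ty ι} :
    ∀ {Γ : Ctx ι}, Wk Θ Γ → Var Γ A → Exp (.tm Θ A)
  | _, w, .zero => contract (clos one (pow w))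
  | _, w, .succ v => reifyVar (.drop w) v

theorem reifyVar_eq (w : Wk Θ Γ) (v : Var Γ A) : reifyVar w v = reifyVar .refl (w.var _ v) := by
  induction w with
  | refl => rfl
  | drop _ ih => exact ih (.succ v)

theorem eval_reifyVar (w : Wk Θ Γ) (v : Var Γ A) : eval (reifyVar w v) = .var (w.var _ v) := by
  induction v with
  | zero => simp only [reifyVar, eval_contract, eval, eval_pow, CTm.sub, CTm.lookup_tab]
  | succ _ ih => exact ih _

theorem contract_one_id : contract (clos one id) = (one : Exp (.tm (A :: Γ) A)) :=
  contract_eq (.id _) fun _ h => by cases h; rfl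

theorem contract_mvar_id (n : ℕ) : contract (clos (mvar Γ A n) id) = mvar Γ A n :=
  contract_eq (.id _) fun _ h => by cases h; rfl

theorem contract_one_pow_drop (w : Wk Θ (B :: A :: Γ)) :
    contract (clos one (pow w.drop)) = clos one (pow w.drop) :=
  contract_eq_self fun _ h => by cases w <;> cases h

theorem contract_cons_pow (w : Wk Θ (A :: Γ)) :
    contract (cons (contract (clos one (pow w))) (pow w.drop)) = pow w := by
  cases w with
  | refl =>
    rw [pow, contract_one_id]
    exact contract_eq .varShift fun _ h => by cases h; rfl
  | drop w =>
    rw [contract_one_pow_drop]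
    exact contract_eq (.sCons _) fun _ h => by cases h; rfl

/-- The λσ-expression of a contextual term; it is in normal form for `σ`. -/
noncomputable def reify : ∀ {Γ : Ctx ι} {o : Obj ι}, CTm Γ o → Exp (o.kind Γ)
  | _, _, .var v => reifyVar .refl v
  | _, _, .mvar Δ A n s => contract (clos (mvar Δ A n) (reify s))
  | _, _, .app a b => app (reify a) (reify b)
  | _, _, .lam a => lam (reify a)
  | _, _, .nil => pow (Wk.toNil .refl)
  | _, _, .cons a s => contract (cons (reify a) (reify s))

/-- Evaluation, at the kind given by a classifier. -/
def evalObj : ∀ {o : Obj ι} {Γ : Ctx ι}, Exp (o.kind Γ) → CTm Γ o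
  | .ty _, _, e => eval e
  | .cx _, _, e => eval e

theorem evalObj_reify (t : CTm Γ o) : evalObj (reify t) = t := by
  induction t with
  | var v => exact eval_reifyVar _ _
  | mvar Δ A n s ih =>
    simp only [evalObj] at ih
    simp only [reify, evalObj, eval_contract, eval, ih, CTm.sub, CTm.sub_tab, CTm.tab_lookup]
  | app a b iha ihb => exact congrArg₂ CTm.app iha ihb
  | lam a ih => exact congrArg CTm.lam ih
  | nil => exact eval_pow _
  | cons a s iha ihs =>
    simp only [reify, evalObj, eval_contract]
    exact congrArg₂ CTm.cons iha ihs

theorem reify_injective : Function.Injective (reify : CTm Γ o → Exp (o.kind Γ)) :=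
  Function.LeftInverse.injective evalObj_reify

theorem reify_tab_var (w : Wk Θ Γ) : reify (.tab fun _ v => .var (w.var _ v)) = pow w := by
  induction Γ with
  | nil => exact congrArg pow (Wk.toNil_eq w).symm
  | cons A Γ ih =>
    have tail : reify (.tab fun _ v => .var (w.var _ (.succ v))) = pow w.drop := ih w.drop
    calc reify (.tab fun _ v => .var (w.var _ v))
        = contract (cons (reifyVar .refl (w.var _ .zero)) (pow w.drop)) :=
          congrArg (fun s => contract (cons _ s)) tail
      _ = contract (cons (contract (clos one (pow w))) (pow w.drop)) := by
          rw [← reifyVar_eq]; rfl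
      _ = pow w := contract_cons_pow w

theorem reify_zero : reify (.var .zero) = (one : Exp (.tm (A :: Γ) A)) := contract_one_id

theorem reify_id : reify (.tab fun _ v => .var v) = (id : Exp (.sb Γ Γ)) :=
  reify_tab_var .refl

theorem reify_shift : reify (.tab fun _ v => .var (.succ v)) = (shift : Exp (.sb (A :: Γ) Γ)) :=
  reify_tab_var (.drop .refl : Wk (A :: Γ) Γ)

theorem eq_of_reify_eq_pow {s : CTm Θ (.cx Γ)} {w : Wk Θ Γ} (h : reify s = pow w) :
    s = .tab fun _ v => .var (w.var _ v) :=
  reify_injective (h.trans (reify_tab_var w).symm)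

/-! ### Every expression reduces to the reification of its value -/

/-- Being of the form `a.s`. -/
def IsCons : ∀ {k : Kind ι}, Exp k → Prop
  | _, cons _ _ => True
  | _, _ => False

theorem exists_pow_of_sigmaRule_cons {a : Exp (.tm Θ A)} {s : Exp (.sb Θ Γ)}
    {x : Exp (.sb Θ (A :: Γ))} (hs : IsCons s ∨ ∃ w, s = pow w) (h : SigmaRule (cons a s) x) :
    ∃ w, x = pow w := by
  cases h with
  | varShift => exact ⟨.refl, rfl⟩
  | sCons =>
    obtain hs | ⟨w, hw⟩ := hs
    · exact hs.elim
    · rcases w with _ | _ | w <;> cases hw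
      exact ⟨_, rfl⟩

theorem isCons_reify_or_eq_pow (s : CTm Θ (.cx Γ)) : IsCons (reify s) ∨ ∃ w, reify s = pow w := by
  induction Γ with
  | nil => cases s; exact .inr ⟨_, rfl⟩
  | cons A Γ ih =>
    cases s with
    | cons a s =>
      rcases contract_spec (cons (reify a) (reify s)) with h | ⟨h, -⟩
      · exact .inr (exists_pow_of_sigmaRule_cons (ih s) h)
      · rw [reify, h]
        exact .inl trivial

theorem reify_cons_cases (a : CTm Θ (.ty A)) (s : CTm Θ (.cx Γ)) :
    (reify (.cons a s) = cons (reify a) (reify s) ∧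
      ∀ x, ¬ SigmaRule (cons (reify a) (reify s)) x) ∨
    ∃ w : Wk Θ (A :: Γ), CTm.cons a s = .tab fun _ v => .var (w.var _ v) := by
  rcases contract_spec (cons (reify a) (reify s)) with h | h
  · obtain ⟨w, hw⟩ := exists_pow_of_sigmaRule_cons (isCons_reify_or_eq_pow s) h
    exact .inr ⟨w, eq_of_reify_eq_pow (s := .cons a s) hw⟩
  · exact .inl h

theorem steps_comp_shift_contract_cons (a : Exp (.tm Θ A)) (s : Exp (.sb Θ Γ)) :
    SigmaSteps (comp shift (contract (cons a s))) s := by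
  rcases contract_spec (cons a s) with h | ⟨h, -⟩
  · generalize contract (cons a s) = x at h
    cases h with
    | varShift => exact .root (.idR _)
    | sCons => exact .refl _
  · rw [h]
    exact .root (.shiftCons _ _)

theorem steps_clos_one_contract_cons (a : Exp (.tm Θ A)) (s : Exp (.sb Θ Γ)) :
    SigmaSteps (clos one (contract (cons a s))) a := by
  rcases contract_spec (cons a s) with h | ⟨h, -⟩
  · generalize contract (cons a s) = x at h
    cases h with
    | varShift => exact .root (.id _)
    | sCons => exact .refl _
  · rw [h]
    exact .root (.varCons _ _)

theorem steps_pow_comp (w : Wk Θ Γ) (s : CTm Δ (.cx Θ)) :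
    SigmaSteps (comp (pow w) (reify s)) (reify (.tab fun _ v => s.lookup _ (w.var _ v))) := by
  induction w with
  | refl =>
    have tab_eq : CTm.tab (fun _ v => s.lookup _ v) = s := s.tab_lookup
    simp only [Wk.var, tab_eq]
    exact .root (.idL _)
  | drop w ih =>
    cases w with
    | refl =>
      cases s with
      | cons a s =>
        have tail : SigmaSteps (comp shift (reify (.cons a s))) (reify s) :=
          steps_comp_shift_contract_cons _ _
        simpa only [pow, shiftComp, Wk.var, CTm.lookup, CTm.tab_lookup] using tail
    | drop w =>
      exact .trans (.root (.assoc _ _ _))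
        (.trans (.comp (.refl _) ih) (steps_comp_shift_contract_cons _ _))

theorem steps_reifyVar_clos (w : Wk Θ Γ) (v : Var Γ A) (s : CTm Δ (.cx Θ)) :
    SigmaSteps (clos (reifyVar w v) (reify s)) (reify (s.lookup _ (w.var _ v))) := by
  induction v with
  | zero =>
    cases w with
    | refl =>
      cases s with
      | cons a s =>
        simp only [reifyVar, pow, contract_one_id]
        exact steps_clos_one_contract_cons _ _
    | drop w =>
      rw [reifyVar, contract_one_pow_drop]
      exact .trans (.root (.clos _ _ _))
        (.trans (.clos (.refl _) (steps_pow_comp _ _)) (steps_clos_one_contract_cons _ _))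
  | succ _ ih => exact ih _

/-- Reduction of the closure by `s` of `t`, or of every component of the tuple `t`, to the
reification of its value. -/
def ClosSteps (s : CTm Δ (.cx Γ)) : ∀ {o : Obj ι}, CTm Γ o → Prop
  | .ty _, t => SigmaSteps (clos (reify t) (reify s)) (reify (CTm.sub s.lookup t))
  | .cx _, r => ∀ A v, SigmaSteps (clos (reify (r.lookup A v)) (reify s))
      (reify (CTm.sub s.lookup (r.lookup A v)))

theorem ClosSteps.comp {s : CTm Δ (.cx Θ)} {r : CTm Θ (.cx Γ)} (h : ClosSteps s r) :
    SigmaSteps (comp (reify r) (reify s)) (reify (CTm.sub s.lookup r)) := by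
  induction Γ with
  | nil => cases r; exact steps_pow_comp _ _
  | cons A Γ ih =>
    cases r with
    | cons a r =>
      rcases reify_cons_cases a r with ⟨hr, -⟩ | ⟨w, hw⟩
      · rw [hr]
        have tail : ClosSteps s r := fun B v => h B (.succ v)
        exact .trans (.root (.map _ _ _))
          (.trans (.cons (h A .zero) (ih tail)) (steps_contract _))
      · rw [hw, reify_tab_var, CTm.sub_tab]
        exact steps_pow_comp w s

theorem ClosSteps.mvar {s : CTm Δ (.cx Γ)} {r : CTm Γ (.cx Θ)} (h : ClosSteps s r) (n : ℕ) :
    ClosSteps s (.mvar Θ A n r) := by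
  simp only [ClosSteps, reify]
  rcases contract_spec (Exp.clos (Exp.mvar Θ A n) (reify r)) with hr | ⟨hr, -⟩
  · generalize contract (Exp.clos (Exp.mvar Θ A n) (reify r)) = x at hr
    generalize reify_r : reify r = r' at hr
    cases hr with
    | id =>
      obtain rfl : r = .tab fun _ v => .var v := reify_injective (reify_r.trans reify_id.symm)
      simp only [CTm.sub_tab, CTm.sub, CTm.tab_lookup]
      exact steps_contract _
  · rw [hr]
    exact .trans (.root (.clos _ _ _)) (.trans (.clos (.refl _) h.comp) (steps_contract _))

/-- The tuple `1.(s ∘ ↑)`. -/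
def liftTuple (s : CTm Δ (.cx Γ)) (A : Ty ι) : CTm (A :: Δ) (.cx (A :: Γ)) :=
  .cons (.var .zero) (CTm.shift s)

theorem lookup_liftTuple (s : CTm Δ (.cx Γ)) (A : Ty ι) :
    (liftTuple s A).lookup = CTm.liftEnv s.lookup A := by
  rw [liftTuple, CTm.lookup_cons, CTm.shift, CTm.lookup_ren]
  rfl

theorem ClosSteps.lam {s : CTm Δ (.cx Γ)} {a : CTm (A :: Γ) (.ty B)}
    (hs : SigmaSteps (Exp.comp (reify s) (shift : Exp (.sb (A :: Δ) Δ))) (reify s.shift))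
    (ha : ClosSteps (liftTuple s A) a) : ClosSteps s (.lam a) := by
  have lifted : SigmaSteps (cons one (Exp.comp (reify s) shift)) (reify (liftTuple s A)) := by
    rw [liftTuple, reify, reify_zero]
    exact .trans (.cons (.refl _) hs) (steps_contract _)
  simp only [ClosSteps, lookup_liftTuple] at ha
  exact .trans (.root (.abs _ _)) (.lam (.trans (.clos (.refl _) lifted) ha))

-- Going below an abstraction needs the reduction of `s ∘ ↑`, which is an instance of the claim for
-- the closure by `↑`. The circle is broken by proving the claim first for tuples of variables.
theorem closSteps_of_invariant (K : ∀ {Γ Δ : Ctx ι}, CTm Δ (.cx Γ) → Prop)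
    (liftTuple_mem : ∀ {Γ Δ : Ctx ι} {s : CTm Δ (.cx Γ)} (A : Ty ι), K s → K (liftTuple s A))
    (steps_comp_shift : ∀ {Γ Δ : Ctx ι} {s : CTm Δ (.cx Γ)} (A : Ty ι), K s →
      SigmaSteps (comp (reify s) (shift : Exp (.sb (A :: Δ) Δ))) (reify s.shift))
    (t : CTm Γ o) {s : CTm Δ (.cx Γ)} (hs : K s) : ClosSteps s t := by
  induction t generalizing Δ with
  | var v => exact steps_reifyVar_clos .refl v s
  | mvar Θ A n r ih => exact (ih hs).mvar n
  | app a b iha ihb => exact .trans (.root (.app _ _ _)) (.app (iha hs) (ihb hs))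
  | lam a ih => exact .lam (steps_comp_shift _ hs) (ih (liftTuple_mem _ hs))
  | nil => exact nofun
  | cons a r iha ihr =>
    exact fun
      | _, .zero => iha hs
      | _, .succ v => ihr hs _ v

theorem ClosSteps.comp_shift {s : CTm Δ (.cx Γ)}
    (h : ClosSteps (.tab fun _ v => .var (.succ v) : CTm (A :: Δ) (.cx Δ)) s) :
    SigmaSteps (Exp.comp (reify s) (shift : Exp (.sb (A :: Δ) Δ))) (reify s.shift) := by
  simpa only [reify_shift, CTm.lookup_tab, ← CTm.ren_eq_sub] using h.comp

/-- Tuples of variables. -/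
def IsRen (s : CTm Δ (.cx Γ)) : Prop := ∀ A v, ∃ w, s.lookup A v = .var w

theorem IsRen.liftTuple {s : CTm Δ (.cx Γ)} (hs : IsRen s) (A : Ty ι) : IsRen (liftTuple s A) := by
  rw [IsRen, lookup_liftTuple]
  rintro B (_ | v)
  · exact ⟨_, rfl⟩
  · obtain ⟨w, hw⟩ := hs B v
    exact ⟨.succ w, congrArg CTm.shift hw⟩

theorem closSteps_of_isRen (t : CTm Γ o) {s : CTm Δ (.cx Γ)} (hs : IsRen s) : ClosSteps s t := by
  refine closSteps_of_invariant IsRen (fun A hs => hs.liftTuple A) (fun A hs => ?_) t hs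
  refine ClosSteps.comp_shift fun B v => ?_
  obtain ⟨w, hw⟩ := hs B v
  rw [hw]
  exact steps_reifyVar_clos .refl w _

theorem closSteps (s : CTm Δ (.cx Γ)) (t : CTm Γ o) : ClosSteps s t := by
  refine closSteps_of_invariant (fun _ => True) (fun _ _ => trivial) (fun A _ => ?_) t trivial
  refine ClosSteps.comp_shift (closSteps_of_isRen _ fun B v => ?_)
  rw [CTm.lookup_tab]
  exact ⟨_, rfl⟩

/-- Reification, at a given kind. -/
noncomputable def reifyKind : ∀ {k : Kind ι}, CTm k.dom k.obj → Exp k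
  | .tm _ _, t => reify t
  | .sb _ _, s => reify s

theorem steps_reifyKind_eval (e : Exp k) : SigmaSteps e (reifyKind (eval e)) := by
  induction e with
  | one => simp only [reifyKind, eval, reify_zero]; exact .refl _
  | mvar Γ A n => simp only [reifyKind, eval, reify, reify_id, contract_mvar_id]; exact .refl _
  | app a b iha ihb => exact .app iha ihb
  | lam a ih => exact .lam ih
  | clos a s iha ihs => exact .trans (.clos iha ihs) (closSteps (eval s) (eval a))
  | id => simp only [reifyKind, eval, reify_id]; exact .refl _
  | shift => simp only [reifyKind, eval, reify_shift]; exact .refl _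
  | cons a s iha ihs => exact .trans (.cons iha ihs) (steps_contract _)
  | comp s t ihs iht => exact .trans (.comp ihs iht) (closSteps (eval t) (eval s)).comp

theorem sigmaConv_of_eval_eq (h : eval e = eval e') : SigmaConv e e' :=
  .trans _ _ _ (h ▸ (steps_reifyKind_eval e).sigmaConv)
    (.symm _ _ (steps_reifyKind_eval e').sigmaConv)

/-! ### Normal forms of `λσ` -/

theorem irred_tab_var (ρ : Ren Δ Γ) : CTm.Irred (.tab fun _ v => .var (ρ _ v)) := by
  induction Δ with
  | nil => exact nofun
  | cons A Δ ih =>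
    exact fun
      | _, .consL _ h => nomatch h
      | _, .consR _ h => ih _ _ h

theorem not_step_one (e : Exp (.tm (A :: Γ) A)) : ¬ LambdaSigmaStep one e
  | .root (.sigma h) => nomatch h

theorem not_step_mvar {n : ℕ} (e : Exp (.tm Γ A)) : ¬ LambdaSigmaStep (mvar Γ A n) e
  | .root (.sigma h) => nomatch h

theorem not_step_shift (e : Exp (.sb (A :: Γ) Γ)) : ¬ LambdaSigmaStep shift e
  | .root (.sigma h) => nomatch h

theorem not_step_pow (w : Wk Θ Γ) (e : Exp (.sb Θ Γ)) : ¬ LambdaSigmaStep (pow w) e := by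
  induction w with
  | refl => exact fun | .root (.sigma h) => nomatch h
  | drop w ih =>
    intro h
    cases w with
    | refl => exact not_step_shift _ h
    | drop w =>
      cases h with
      | root h =>
        cases h with
        | sigma h => cases w <;> cases h
      | compL _ h => exact not_step_shift _ h
      | compR _ h => exact ih _ h

theorem not_step_reifyVar (w : Wk Θ Γ) (v : Var Γ A) (e : Exp (.tm Θ A)) :
    ¬ LambdaSigmaStep (reifyVar w v) e := by
  induction v with
  | zero =>
    cases w with
    | refl => simpa only [reifyVar, pow, contract_one_id] using not_step_one e
    | drop w =>
      simp only [reifyVar, contract_one_pow_drop]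
      intro h
      cases h with
      | root h =>
        cases h with
        | sigma h => cases w <;> cases h
      | closL _ h => exact not_step_one _ h
      | closR _ h => exact not_step_pow _ _ h
  | succ _ ih => exact ih _ _

theorem reify_mvar_cases (Δ : Ctx ι) (A : Ty ι) (n : ℕ) (s : CTm Γ (.cx Δ)) :
    (reify (.mvar Δ A n s) = clos (mvar Δ A n) (reify s) ∧
      ∀ x, ¬ SigmaRule (clos (mvar Δ A n) (reify s)) x) ∨
    (CTm.Irred s ∧ ∀ e, ¬ LambdaSigmaStep (reify (.mvar Δ A n s)) e) := by
  rcases contract_spec (clos (mvar Δ A n) (reify s)) with h | h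
  · right
    simp only [reify]
    generalize contract (clos (mvar Δ A n) (reify s)) = x at h
    generalize reify_s : reify s = s' at h
    cases h with
    | id =>
      obtain rfl : s = .tab fun _ v => .var v := reify_injective (reify_s.trans reify_id.symm)
      exact ⟨irred_tab_var _, not_step_mvar⟩
  · exact .inl h

theorem steps_reify_beta (a : CTm (A :: Γ) (.ty B)) (b : CTm Γ (.ty A)) :
    LambdaSigmaSteps (reify (.app (.lam a) b)) (reify (CTm.sub (CTm.single b) a)) := by
  have tuple : SigmaSteps (cons (reify b) id) (reify (.cons b (.tab fun _ v => .var v))) := by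
    rw [reify, reify_id]
    exact steps_contract _
  have body := closSteps (.cons b (.tab fun _ v => .var v)) a
  simp only [ClosSteps, CTm.lookup_cons, CTm.lookup_tab] at body
  exact .trans (.root (.beta _ _)) (CSteps.trans (.clos (.refl _) tuple) body).toLambdaSigma

theorem steps_reify_eta {p : CTm (A :: Γ) (.ty (.arrow A B))} {a : CTm Γ (.ty (.arrow A B))}
    (h : p = CTm.shift a) : LambdaSigmaSteps (reify (.lam (.app p (.var .zero)))) (reify a) := by
  have eval_p : eval (reify p) = p := evalObj_reify p
  have eval_a : eval (reify a) = a := evalObj_reify a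
  simp only [reify, reifyVar, pow, contract_one_id]
  refine .root (.eta _ _ (sigmaConv_of_eval_eq ?_))
  rw [eval_clos_shift, eval_p, eval_a, h]

theorem steps_reify_of_step {t t' : CTm Γ o} (h : CTm.Step t t') :
    LambdaSigmaSteps (reify t) (reify t') := by
  induction h with
  | beta a b => exact steps_reify_beta a b
  | eta h => exact steps_reify_eta h
  | mvar Δ A n h ih =>
    rcases reify_mvar_cases Δ A n _ with ⟨h', -⟩ | ⟨irred, -⟩
    · rw [h']
      exact .trans (.clos (.refl _) ih) (steps_contract _).toLambdaSigma
    · exact (irred _ h).elim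
  | appL _ _ ih => exact .app ih (.refl _)
  | appR _ _ ih => exact .app (.refl _) ih
  | lam _ ih => exact .lam ih
  | consL s h ih =>
    rcases reify_cons_cases _ s with ⟨h', -⟩ | ⟨w, hw⟩
    · rw [h']
      exact .trans (.cons ih (.refl _)) (steps_contract _).toLambdaSigma
    · exact (irred_tab_var _ _ (hw ▸ h.consL s)).elim
  | consR a h ih =>
    rcases reify_cons_cases a _ with ⟨h', -⟩ | ⟨w, hw⟩
    · rw [h']
      exact .trans (.cons (.refl _) ih) (steps_contract _).toLambdaSigma
    · exact (irred_tab_var _ _ (hw ▸ h.consR a)).elim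

theorem steps_reify {t t' : CTm Γ o} (h : CTm.Steps t t') :
    LambdaSigmaSteps (reify t) (reify t') :=
  ReflTransGen.lift' reify (fun _ _ => steps_reify_of_step) _ _ h

theorem not_step_reify_app {a : CTm Γ (.ty (.arrow A B))} {b : CTm Γ (.ty A)}
    (irred : CTm.Irred (.app a b)) (ha : ∀ e, ¬ LambdaSigmaStep (reify a) e)
    (hb : ∀ e, ¬ LambdaSigmaStep (reify b) e) (e : Exp (.tm Γ B)) :
    ¬ LambdaSigmaStep (reify (.app a b)) e := by
  simp only [reify]
  generalize reify_a : reify a = a' at ha ⊢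
  intro h
  cases h with
  | root h =>
    cases h with
    | sigma h => cases h
    | beta c =>
      obtain rfl : a = .lam (eval c) := by rw [← evalObj_reify a, reify_a]; rfl
      exact irred _ (.beta _ _)
  | appL _ h => exact ha _ h
  | appR _ h => exact hb _ h

theorem not_step_reify_lam {a : CTm (A :: Γ) (.ty B)} (irred : CTm.Irred (.lam a))
    (ha : ∀ e, ¬ LambdaSigmaStep (reify a) e) (e : Exp (.tm Γ (.arrow A B))) :
    ¬ LambdaSigmaStep (reify (.lam a)) e := by
  simp only [reify]
  generalize reify_a : reify a = a' at ha ⊢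
  intro h
  cases h with
  | root h =>
    cases h with
    | sigma h => cases h
    | eta c _ h =>
      obtain rfl : a = .app (eval c) (.var .zero) := by rw [← evalObj_reify a, reify_a]; rfl
      exact irred _ (.eta (by rw [h.eval_eq, eval_clos_shift]))
  | lam h => exact ha _ h

theorem not_step_reify (t : CTm Γ o) (irred : t.Irred) (e : Exp (o.kind Γ)) :
    ¬ LambdaSigmaStep (reify t) e := by
  induction t with
  | var v => exact not_step_reifyVar _ _ _
  | mvar Δ A n s ih =>
    rcases reify_mvar_cases Δ A n s with ⟨h', not_rule⟩ | ⟨-, not_step⟩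
    · rw [h']
      exact fun
        | .root (.sigma h) => not_rule _ h
        | .closL _ h => not_step_mvar _ h
        | .closR _ h => ih (fun _ h => irred _ (.mvar _ _ _ h)) _ h
    · exact not_step e
  | app a b iha ihb =>
    exact not_step_reify_app irred (iha fun _ h => irred _ (.appL _ h))
      (ihb fun _ h => irred _ (.appR _ h)) e
  | lam a ih => exact not_step_reify_lam irred (ih fun _ h => irred _ (.lam h)) e
  | nil => exact not_step_pow _ _
  | cons a s iha ihs =>
    rcases reify_cons_cases a s with ⟨h', not_rule⟩ | ⟨w, hw⟩
    · rw [h']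
      exact fun
        | .root (.sigma h) => not_rule _ h
        | .consL _ h => iha (fun _ h => irred _ (.consL _ h)) _ h
        | .consR _ h => ihs (fun _ h => irred _ (.consR _ h)) _ h
    · rw [hw, reify_tab_var]
      exact not_step_pow _ _

theorem eq_of_steps_of_not_step (h : LambdaSigmaSteps e e') (hn : ∀ x, ¬ LambdaSigmaStep e x) :
    e = e' := by
  obtain rfl | ⟨x, hx, -⟩ := ReflTransGen.cases_head h
  · rfl
  · exact (hn x hx).elim

namespace IsNormalFormOf

variable {a a' : Exp (.tm Γ A)}

theorem eq_reify (h : a'.IsNormalFormOf a) : a' = reify (eval a') :=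
  eq_of_steps_of_not_step (steps_reifyKind_eval a').toLambdaSigma h.2

theorem irred_eval (h : a'.IsNormalFormOf a) : (eval a').Irred := by
  intro t ht
  have steps : LambdaSigmaSteps a' (reify t) := by
    rw [h.eq_reify]
    exact steps_reify_of_step ht
  exact ht.ne (reify_injective (h.eq_reify.symm.trans (eq_of_steps_of_not_step steps h.2)))

theorem eval_steps (h : a'.IsNormalFormOf a) : CTm.Steps (eval a) (eval a') := Exp.eval_steps h.1

end IsNormalFormOf

theorem existsUnique_isNormalFormOf (a : Exp (.tm Γ A)) : ∃! a', IsNormalFormOf a' a := by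
  obtain ⟨t, steps, irred⟩ := CTm.exists_irred (eval a)
  refine ⟨reify t, ⟨?_, not_step_reify t irred⟩, fun a' h => ?_⟩
  · exact (steps_reifyKind_eval a).toLambdaSigma.trans (steps_reify steps)
  · rw [h.eq_reify]
    exact congrArg reify (h.irred_eval.eq_of_join irred (CTm.confluence h.eval_steps steps))

end Exp

/-! ### Grafting of contextual terms -/

namespace CTm

variable {ι : Type u} {Γ Δ : Ctx ι} {o : Obj ι}

/-- Replacement of metavariables: `X[s]` becomes `(θ X)[s]`. -/
def graft (θ : ∀ (Γ : Ctx ι) (A : Ty ι), ℕ → CTm Γ (.ty A)) :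
    ∀ {Γ : Ctx ι} {o : Obj ι}, CTm Γ o → CTm Γ o
  | _, _, var v => var v
  | _, _, mvar Δ A n s => sub (lookup (graft θ s)) (θ Δ A n)
  | _, _, app a b => app (graft θ a) (graft θ b)
  | _, _, lam a => lam (graft θ a)
  | _, _, nil => nil
  | _, _, cons a s => cons (graft θ a) (graft θ s)

variable (θ : ∀ (Γ : Ctx ι) (A : Ty ι), ℕ → CTm Γ (.ty A))

theorem graft_ren (ρ : Ren Γ Δ) (t : CTm Γ o) : graft θ (ren ρ t) = ren ρ (graft θ t) := by
  induction t generalizing Δ with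
  | mvar _ _ _ s ih => simp only [ren, graft, ih, lookup_ren, ren_sub]
  | _ => simp only [ren, graft, *]

theorem graft_liftEnv (τ : Env Γ Δ) (A : Ty ι) :
    (fun C v => graft θ (liftEnv τ A C v)) = liftEnv (fun _ v => graft θ (τ _ v)) A := by
  funext C v
  cases v with
  | zero => rfl
  | succ v => exact graft_ren θ _ _

theorem graft_sub (τ : Env Γ Δ) (t : CTm Γ o) :
    graft θ (sub τ t) = sub (fun _ v => graft θ (τ _ v)) (graft θ t) := by
  induction t generalizing Δ with
  | mvar _ _ _ s ih => simp only [sub, graft, ih, lookup_sub, CTm.sub_sub]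
  | lam a ih => simp only [sub, graft, ih, graft_liftEnv]
  | _ => simp only [sub, graft, *]

theorem graft_single {B : Ty ι} (b : CTm Γ (.ty B)) :
    (fun C v => graft θ (single b C v)) = single (graft θ b) := by
  funext C v; cases v <;> rfl

theorem graft_tab (τ : Env Δ Γ) : graft θ (tab τ) = tab fun _ v => graft θ (τ _ v) := by
  induction Δ with
  | nil => rfl
  | cons A Δ ih => exact congrArg (cons _) (ih _)

theorem lookup_graft (s : CTm Γ (.cx Δ)) :
    lookup (graft θ s) = fun _ v => graft θ (lookup s _ v) := by
  conv_lhs => rw [← tab_lookup s, graft_tab, lookup_tab]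

theorem graft_mvar_tab_var (A : Ty ι) (n : ℕ) :
    graft θ (mvar Γ A n (tab fun _ v => var v)) = θ Γ A n := by
  simp only [graft, graft_tab, lookup_tab, sub_var]

variable {t t' : CTm Γ o}

theorem Step.graft (h : Step t t') : Steps (graft θ t) (graft θ t') := by
  induction h with
  | beta a b =>
    rw [graft_sub, graft_single]
    exact .single (.beta _ _)
  | eta h => exact .single (.eta (h ▸ graft_ren θ _ _))
  | mvar _ _ _ _ ih => exact Steps.sub_env _ ih.lookup
  | appL _ _ ih => exact ih.app .refl
  | appR _ _ ih => exact Steps.app .refl ih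
  | lam _ ih => exact ih.lam
  | consL _ _ ih => exact ih.cons .refl
  | consR _ _ ih => exact Steps.cons .refl ih

theorem Steps.graft (h : Steps t t') : Steps (graft θ t) (graft θ t') :=
  ReflTransGen.lift' (CTm.graft θ) (fun _ _ => Step.graft θ) _ _ h

end CTm

/-! ### The value of an expanded precooked term -/

/-- The renaming given by a depth. -/
def Depth.var {ι : Type u} {Γ : Ctx ι} : ∀ {Θ : Ctx ι}, Depth Γ Θ → Ren Γ Θ
  | _, .zero, _, v => v
  | _, .succ d, _, v => .succ (d.var _ v)

theorem Var.depth_var {ι : Type u} {Γ : Ctx ι} {A : Ty ι} (v : Var Γ A) :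
    v.depth.var A .zero = v := by
  induction v with
  | zero => rfl
  | succ _ ih => exact congrArg Var.succ ih

namespace Exp

variable {ι : Type u} {Γ Θ : Ctx ι} {k : Kind ι} (θ : ∀ (Γ : Ctx ι) (A : Ty ι), ℕ → Exp (.tm Γ A))

theorem eval_graft (e : Exp k) :
    (e.graft θ).eval = CTm.graft (fun Γ A n => (θ Γ A n).eval) e.eval := by
  induction e with
  | one => rfl
  | mvar Γ A n => exact (CTm.graft_mvar_tab_var (fun Γ A n => (θ Γ A n).eval) A n).symm
  | app a b iha ihb => exact congrArg₂ CTm.app iha ihb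
  | lam a ih => exact congrArg CTm.lam ih
  | clos | comp => simp only [graft, eval, CTm.graft_sub, CTm.lookup_graft, *]
  | id | shift => simp only [graft, eval, CTm.graft_tab, CTm.graft]
  | cons a s iha ihs => exact congrArg₂ CTm.cons iha ihs

theorem lookup_eval_shiftPow (d : Depth Γ Θ) :
    CTm.lookup (shiftPow d).eval = fun _ v => CTm.var (d.var _ v) := by
  induction d with
  | zero => exact CTm.lookup_tab _
  | succ d ih =>
    simp only [shiftPow, eval, CTm.lookup_sub, CTm.lookup_tab, ih, CTm.sub]
    rfl

theorem graft_shiftPow (d : Depth Γ Θ) : (shiftPow d).graft θ = shiftPow d := by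
  induction d with
  | zero => rfl
  | succ _ ih => exact congrArg (comp · shift) ih

end Exp

namespace Lam

variable {ι : Type u} {Γ Θ : Ctx ι} {A B : Ty ι} (ν : Ctx ι → Ty ι → ℕ → ℕ)

/-- The value of the precooked term, after `X ↦ λ ⋯ λ Y`. -/
def value {Γ : Ctx ι} : ∀ {Θ : Ctx ι} {A : Ty ι}, Depth Γ Θ → Lam Θ A → CTm Θ (.ty A)
  | _, _, _, var v => .var v
  | _, _, d, mvar A n => CTm.ren d.var (Exp.lamsMVar A Γ (ν Γ A n)).eval
  | _, _, d, app a b => .app (value d a) (value d b)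
  | _, _, d, lam a => .lam (value d.succ a)

theorem eval_expand_precookAt (d : Depth Γ Θ) (a : Lam Θ A) :
    ((precookAt d a).expand ν).eval = value ν d a := by
  induction a with
  | var v =>
    simp only [precookAt, Exp.expand, Exp.graft, Exp.graft_shiftPow, Exp.eval, CTm.sub,
      Exp.lookup_eval_shiftPow]
    exact congrArg CTm.var v.depth_var
  | mvar A n =>
    simp only [precookAt, Exp.expand, Exp.graft, Exp.graft_shiftPow, Exp.eval, value,
      Exp.lookup_eval_shiftPow, CTm.ren_eq_sub]
  | app a b iha ihb => exact congrArg₂ CTm.app (iha d) (ihb d)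
  | lam a ih => exact congrArg CTm.lam (ih d.succ)

theorem eval_expand_precook (a : Lam Γ A) : (a.precook.expand ν).eval = value ν .zero a :=
  eval_expand_precookAt ν .zero a

/-! ### From contextual terms to λ-terms -/

namespace Conv

variable {a a' : Lam Γ A}

theorem map {Δ : Ctx ι} {f : Lam Γ A → Lam Δ B} (hf : ∀ x y, Step x y → Step (f x) (f y))
    (h : Conv a a') : Conv (f a) (f a') := by
  induction h with
  | rel _ _ h => exact .rel _ _ (hf _ _ h)
  | refl => exact .refl _
  | symm _ _ _ ih => exact .symm _ _ ih
  | trans _ _ _ _ _ ih ih' => exact .trans _ _ _ ih ih'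

theorem app {f f' : Lam Γ (.arrow A B)} (hf : Conv f f') (ha : Conv a a') :
    Conv (app f a) (app f' a') :=
  .trans _ _ _ (hf.map (f := (Lam.app · a)) fun _ _ => .appL _) (ha.map fun _ _ => .appR _)

end Conv

end Lam

namespace CTm

variable {ι : Type u} {Γ Δ Θ : Ctx ι} {A : Ty ι} {o : Obj ι}

/-- The λ-terms with a given classifier; tuples are forgotten. -/
abbrev Collapsed (Γ : Ctx ι) : Obj ι → Type u
  | .ty A => Lam Γ A
  | .cx _ => PUnit

/-- The λ-term in which the tuples of the metavariables are dropped. -/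
def collapse : ∀ {Γ : Ctx ι} {o : Obj ι}, CTm Γ o → Collapsed Γ o
  | _, _, var v => Lam.var v
  | _, _, mvar _ A n _ => Lam.mvar A n
  | _, _, app a b => Lam.app (collapse a) (collapse b)
  | _, _, lam a => Lam.lam (collapse a)
  | _, _, nil => ⟨⟩
  | _, _, cons _ _ => ⟨⟩

/-- Renaming of collapsed terms. -/
def renCollapsed (ρ : Ren Γ Δ) : ∀ {o : Obj ι}, Collapsed Γ o → Collapsed Δ o
  | .ty _, a => Lam.ren ρ a
  | .cx _, _ => ⟨⟩

/-- Substitution of collapsed terms. -/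
def subCollapsed (τ : ∀ A, Var Γ A → Lam Δ A) : ∀ {o : Obj ι}, Collapsed Γ o → Collapsed Δ o
  | .ty _, a => Lam.sub τ a
  | .cx _, _ => ⟨⟩

/-- βη-equality of collapsed terms. -/
def ConvCollapsed : ∀ {o : Obj ι}, Collapsed Γ o → Collapsed Γ o → Prop
  | .ty _, a, b => Lam.Conv a b
  | .cx _, _, _ => True

theorem collapse_ren (ρ : Ren Γ Δ) (t : CTm Γ o) :
    collapse (ren ρ t) = renCollapsed ρ (collapse t) := by
  induction t generalizing Δ with
  | app a b iha ihb => exact congrArg₂ Lam.app (iha ρ) (ihb ρ)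
  | lam a ih => exact congrArg Lam.lam (ih _)
  | _ => rfl

theorem collapse_liftEnv (τ : Env Γ Δ) (A : Ty ι) :
    (fun C v => collapse (liftEnv τ A C v)) = Lam.liftSub (fun _ v => collapse (τ _ v)) A := by
  funext C v
  cases v with
  | zero => rfl
  | succ v => exact collapse_ren _ _

theorem collapse_sub (τ : Env Γ Δ) (t : CTm Γ o) :
    collapse (sub τ t) = subCollapsed (fun _ v => collapse (τ _ v)) (collapse t) := by
  induction t generalizing Δ with
  | app a b iha ihb => exact congrArg₂ Lam.app (iha τ) (ihb τ)
  | lam a ih => exact congrArg Lam.lam ((ih _).trans (by rw [collapse_liftEnv]; rfl))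
  | _ => rfl

theorem collapse_single (b : CTm Γ (.ty A)) :
    (fun C v => collapse (single b C v)) = Lam.single (collapse b) := by
  funext C v; cases v <;> rfl

theorem Step.collapse {t t' : CTm Γ o} (h : Step t t') :
    ConvCollapsed (collapse t) (collapse t') := by
  induction h with
  | beta a b =>
    rw [collapse_sub, collapse_single]
    exact .rel _ _ (.beta _ _)
  | eta h =>
    simp only [h, CTm.collapse, collapse_ren]
    exact .rel _ _ (.eta _)
  | mvar => exact .refl _
  | appL _ _ ih => exact Lam.Conv.app ih (.refl _)
  | appR _ _ ih => exact Lam.Conv.app (.refl _) ih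
  | lam _ ih => exact Lam.Conv.map (fun _ _ => .lam) ih
  | consL | consR => trivial

theorem Steps.collapse {t t' : CTm Γ (.ty A)} (h : Steps t t') :
    Lam.Conv (collapse t) (collapse t') := by
  induction h with
  | refl => exact .refl _
  | tail _ h ih => exact .trans _ _ _ ih h.collapse

theorem ren_depth_zero (t : CTm Γ o) : ren (Depth.zero : Depth Γ Γ).var t = t :=
  (ren_eq_sub _ _).trans (sub_var t)

theorem ren_depth_succ (d : Depth Γ Θ) (t : CTm Γ o) :
    ren (d.succ (A := A)).var t = shift (ren d.var t) :=
  (ren_ren Ren.succ d.var t).symm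

theorem collapse_ren_depth (d : Depth Γ Θ) (t : CTm Γ (.ty A)) :
    collapse (ren d.var t) = Lam.shiftBy (collapse t) d := by
  induction d with
  | zero => rw [ren_depth_zero]; rfl
  | succ d ih => rw [ren_depth_succ, collapse_ren, ih]; rfl

theorem instAt_collapse (ν : Ctx ι → Ty ι → ℕ → ℕ)
    (θ : ∀ (Γ : Ctx ι) (A : Ty ι), ℕ → CTm Γ (.ty A)) (d : Depth Γ Θ) (a : Lam Θ A) :
    Lam.instAt (fun A n => collapse (graft θ (Exp.lamsMVar A Γ (ν Γ A n)).eval)) d a =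
      collapse (graft θ (Lam.value ν d a)) := by
  induction a with
  | var => rfl
  | mvar => simp only [Lam.instAt, Lam.value, graft_ren, collapse_ren_depth]
  | app a b iha ihb => exact congrArg₂ Lam.app (iha d) (ihb d)
  | lam a ih => exact congrArg Lam.lam (ih d.succ)

end CTm

namespace Exp

variable {ι : Type u} {Γ : Ctx ι} {A : Ty ι} {a b : Lam Γ A} {ν : Ctx ι → Ty ι → ℕ → ℕ}
  {a' b' : Exp (.tm Γ A)}

theorem IsNormalFormOf.steps_graft_value (ha : a'.IsNormalFormOf (a.precook.expand ν))
    (U : ∀ (Γ : Ctx ι) (A : Ty ι), ℕ → CTm Γ (.ty A)) :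
    CTm.Steps (CTm.graft U (Lam.value ν .zero a)) (CTm.graft U a'.eval) := by
  rw [← Lam.eval_expand_precook]
  exact ha.eval_steps.graft U

theorem hasSolution_of_hasSigmaSolution (ha : a'.IsNormalFormOf (a.precook.expand ν))
    (hb : b'.IsNormalFormOf (b.precook.expand ν)) (h : HasSigmaSolution a' b') :
    Lam.HasSolution a b := by
  obtain ⟨θ, hθ⟩ := h
  let U : ∀ (Γ : Ctx ι) (A : Ty ι), ℕ → CTm Γ (.ty A) := fun Γ A n => (θ Γ A n).eval
  have eval_eq : CTm.graft U a'.eval = CTm.graft U b'.eval := by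
    simpa only [eval_graft] using hθ.eval_eq
  have conv_a := (ha.steps_graft_value U).collapse
  have conv_b := (hb.steps_graft_value U).collapse
  refine ⟨fun A n => CTm.collapse (CTm.graft U (lamsMVar A Γ (ν Γ A n)).eval), ?_⟩
  simp only [Lam.inst, CTm.instAt_collapse]
  exact .trans _ _ _ (eval_eq ▸ conv_a) (.symm _ _ conv_b)

end Exp

/-! ### From λ-terms to contextual terms -/

namespace Lam

variable {ι : Type u} {Γ Δ Θ : Ctx ι} {A : Ty ι}

/-- A λ-term as a contextual term; its metavariables get the empty context. -/
def embed : ∀ {Γ : Ctx ι} {A : Ty ι}, Lam Γ A → CTm Γ (.ty A)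
  | _, _, var v => .var v
  | _, _, mvar A n => .mvar [] A n .nil
  | _, _, app a b => .app (embed a) (embed b)
  | _, _, lam a => .lam (embed a)

theorem embed_ren (ρ : Ren Γ Δ) (a : Lam Γ A) : embed (ren ρ a) = CTm.ren ρ (embed a) := by
  induction a generalizing Δ with
  | var | mvar => rfl
  | app a b iha ihb => exact congrArg₂ CTm.app (iha ρ) (ihb ρ)
  | lam a ih => exact congrArg CTm.lam (ih _)

theorem embed_liftSub (τ : ∀ A, Var Γ A → Lam Δ A) (B : Ty ι) :
    (fun C v => embed (liftSub τ B C v)) = CTm.liftEnv (fun _ v => embed (τ _ v)) B := by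
  funext C v
  cases v with
  | zero => rfl
  | succ v => exact embed_ren _ _

theorem embed_sub (τ : ∀ A, Var Γ A → Lam Δ A) (a : Lam Γ A) :
    embed (sub τ a) = CTm.sub (fun _ v => embed (τ _ v)) (embed a) := by
  induction a generalizing Δ with
  | lam a ih => simp only [sub, embed, CTm.sub, ih, embed_liftSub]
  | _ => simp only [sub, embed, CTm.sub, *]

theorem embed_single (b : Lam Γ A) :
    (fun C v => embed (single b C v)) = CTm.single (embed b) := by
  funext C v; cases v <;> rfl

theorem Step.embed {a b : Lam Γ A} (h : Step a b) : CTm.Step (embed a) (embed b) := by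
  induction h with
  | beta a b =>
    rw [embed_sub, embed_single]
    exact .beta _ _
  | eta a => exact .eta (embed_ren _ _)
  | appL _ _ ih => exact .appL _ ih
  | appR _ _ ih => exact .appR _ ih
  | lam _ ih => exact .lam ih

theorem Conv.embed {a b : Lam Γ A} (h : Conv a b) : CTm.Join (embed a) (embed b) := by
  induction h with
  | rel _ _ h => exact ⟨_, .single h.embed, .refl⟩
  | refl => exact .of_eq rfl
  | symm _ _ _ ih => exact ih.symm
  | trans _ _ _ _ _ ih ih' => exact (CTm.equivalence_join _ _).trans ih ih'

theorem embed_shiftBy (d : Depth Γ Θ) (a : Lam Γ A) :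
    embed (shiftBy a d) = CTm.ren d.var (embed a) := by
  induction d with
  | zero => exact (CTm.ren_depth_zero _).symm
  | succ d ih =>
    rw [CTm.ren_depth_succ, ← ih]
    exact embed_ren _ _

theorem join_embed_instAt (ν : Ctx ι → Ty ι → ℕ → ℕ) (θ : ∀ A : Ty ι, ℕ → Lam Γ A)
    (U : ∀ (Γ : Ctx ι) (A : Ty ι), ℕ → CTm Γ (.ty A)) (d : Depth Γ Θ) (a : Lam Θ A)
    (h : ∀ X ∈ a.mvars, CTm.Join (embed (θ X.1 X.2))
      (CTm.graft U (Exp.lamsMVar X.1 Γ (ν Γ X.1 X.2)).eval)) :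
    CTm.Join (embed (instAt θ d a)) (CTm.graft U (value ν d a)) := by
  induction a with
  | var v => exact .of_eq rfl
  | mvar A n =>
    simp only [instAt, value, embed_shiftBy, CTm.graft_ren]
    exact (h (A, n) rfl).map _ fun _ _ h => h.ren _
  | app a b iha ihb =>
    obtain ⟨f, steps_f, steps_f'⟩ := iha d fun X hX => h X (.inl hX)
    obtain ⟨c, steps_c, steps_c'⟩ := ihb d fun X hX => h X (.inr hX)
    exact ⟨.app f c, steps_f.app steps_c, steps_f'.app steps_c'⟩
  | lam a ih => exact (ih d.succ h).map _ fun _ _ => .lam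

theorem mem_mvars_precookAt (d : Depth Γ Θ) (a : Lam Θ A) {X : Ty ι × ℕ} (h : X ∈ a.mvars) :
    (Γ, X) ∈ (precookAt d a).mvars := by
  induction a with
  | var => exact h.elim
  | mvar => cases h; exact .inl rfl
  | app a b iha ihb => exact h.imp (iha d) (ihb d)
  | lam a ih => exact ih d.succ h

end Lam

/-! ### Irreducible bodies -/

namespace CTm

variable {ι : Type u} {Γ : Ctx ι}

/-- The term `λ ⋯ λ u`, with one abstraction for each argument type of `A`. -/
def lams : ∀ (A : Ty ι) {Γ : Ctx ι}, CTm (A.bodyCtx Γ) (.ty A.target) → CTm Γ (.ty A)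
  | .base _, _, u => u
  | .arrow _ B, _, u => lam (lams B u)

/-- The body of the η-long form of `t`: the weakened term `t` applied to the new variables. -/
def body : ∀ (A : Ty ι) {Γ : Ctx ι}, CTm Γ (.ty A) → CTm (A.bodyCtx Γ) (.ty A.target)
  | .base _, _, t => t
  | .arrow _ B, _, t => body B (app (shift t) (var .zero))

theorem Steps.lams (A : Ty ι) {u u' : CTm (A.bodyCtx Γ) (.ty A.target)} (h : Steps u u') :
    Steps (lams A u) (lams A u') := by
  induction A generalizing Γ with
  | base i => exact h
  | arrow A B _ ih => exact (ih h).lam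

theorem steps_lams_body (A : Ty ι) (t : CTm Γ (.ty A)) : Steps (lams A (body A t)) t := by
  induction A generalizing Γ with
  | base i => exact .refl
  | arrow A B _ ih => exact (ih _).lam.tail (.eta rfl)

theorem graft_eval_lamsMVar (U : ∀ (Γ : Ctx ι) (A : Ty ι), ℕ → CTm Γ (.ty A)) (A : Ty ι)
    (Γ : Ctx ι) (y : ℕ) :
    graft U (Exp.lamsMVar A Γ y).eval = lams A (U (A.bodyCtx Γ) A.target y) := by
  induction A generalizing Γ with
  | base i => exact graft_mvar_tab_var U _ _
  | arrow A B _ ih => exact congrArg lam (ih _)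

open Exp (newMVar) in
theorem exists_irred_steps_lams (ν : Ctx ι → Ty ι → ℕ → ℕ) {S : Set (Ctx ι × Ty ι × ℕ)}
    (hν : Set.InjOn (newMVar ν) S) (t : ∀ A : Ty ι, ℕ → CTm Γ (.ty A)) :
    ∃ U : ∀ (Γ : Ctx ι) (A : Ty ι), ℕ → CTm Γ (.ty A), (∀ Δ B m, Irred (U Δ B m)) ∧
      ∀ A n, (Γ, A, n) ∈ S →
        Steps (lams A (body A (t A n))) (lams A (U (A.bodyCtx Γ) A.target (ν Γ A n))) := by
  -- The heterogeneous equality lets the sort `(Δ, B)` vary freely, as `choose` requires.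
  have exists_value : ∀ Δ B m, ∃ u : CTm Δ (.ty B), Irred u ∧ ∀ A n, (Γ, A, n) ∈ S →
      newMVar ν (Γ, A, n) = (Δ, B, m) → ∀ u' : CTm (A.bodyCtx Γ) (.ty A.target), HEq u u' →
        Steps (lams A (body A (t A n))) (lams A u') := by
    intro Δ B m
    by_cases h : ∃ A n, (Γ, A, n) ∈ S ∧ newMVar ν (Γ, A, n) = (Δ, B, m)
    · obtain ⟨A, n, hS, hnew⟩ := h
      cases hnew
      obtain ⟨u, hsteps, hirred⟩ := exists_irred (body A (t A n))
      refine ⟨u, hirred, fun A' n' hS' hnew' u' hu => ?_⟩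
      cases hν hS' hS hnew'
      cases hu
      exact hsteps.lams A
    · exact ⟨_, irred_dummy B, fun A n hS hnew => (h ⟨A, n, hS, hnew⟩).elim⟩
  choose U hirred hsteps using exists_value
  exact ⟨U, hirred, fun A n hS => hsteps _ _ _ A n hS rfl _ HEq.rfl⟩

end CTm

/-! ### Metavariables with atomic arguments -/

namespace Ty

variable {ι : Type u}

theorem one_le_order (A : Ty ι) : 1 ≤ A.order := by
  induction A with
  | base => exact le_rfl
  | arrow A B _ ih => exact ih.trans (le_max_right _ _)

theorem isAtomic_of_order_arrow_le_two {A B : Ty ι} (h : (arrow A B).order ≤ 2) :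
    A.IsAtomic := by
  have hA : A.order + 1 ≤ 2 := (le_max_left _ _).trans h
  cases A with
  | base i => exact ⟨i, rfl⟩
  | arrow C D =>
    have hC : C.order + 1 ≤ (arrow C D).order := le_max_left _ _
    have := C.one_le_order
    omega

end Ty

theorem Var.mem {ι : Type u} {Γ : Ctx ι} {A : Ty ι} (v : Var Γ A) : A ∈ Γ := by
  induction v with
  | zero => exact List.mem_cons_self
  | succ _ ih => exact List.mem_cons_of_mem _ ih

namespace CTm

variable {ι : Type u} {Γ Δ Θ Θ' : Ctx ι} {A B : Ty ι} {o : Obj ι}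

/-- Every metavariable has atomic type, and its tuple consists of terms of atomic types and of
variables of the context `Γ`. This is the invariant of reduction that the values of second order
problems satisfy. -/
def Flat {Γ : Ctx ι} : ∀ {Θ : Ctx ι} {o : Obj ι}, Depth Γ Θ → CTm Θ o → Prop
  | _, _, _, var _ => True
  | _, _, d, mvar Δ A _ s => A.IsAtomic ∧
      (∀ B (v : Var Δ B), B.IsAtomic ∨ ∃ w, lookup s B v = var (d.var B w)) ∧ Flat d s
  | _, _, d, app a b => Flat d a ∧ Flat d b
  | _, _, d, lam a => Flat d.succ a
  | _, _, _, nil => True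
  | _, _, d, cons a s => Flat d a ∧ Flat d s

section Flat

variable {d : Depth Γ Θ} {d' : Depth Γ Θ'}

theorem Flat.ren {ρ : Ren Θ Θ'} (hρ : ∀ B w, ρ B (d.var B w) = d'.var B w) {t : CTm Θ o}
    (h : Flat d t) : Flat d' (ren ρ t) := by
  induction t generalizing Θ' with
  | var v => trivial
  | mvar Δ A n s ih =>
    refine ⟨h.1, fun B v => (h.2.1 B v).imp_right ?_, ih hρ h.2.2⟩
    rintro ⟨w, hw⟩
    exact ⟨w, by simp only [lookup_ren, hw, CTm.ren, hρ]⟩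
  | app a b iha ihb => exact ⟨iha hρ h.1, ihb hρ h.2⟩
  | lam a ih => exact ih (d := d.succ) (d' := d'.succ) (fun B w => congrArg Var.succ (hρ B w)) h
  | nil => trivial
  | cons a s iha ihs => exact ⟨iha hρ h.1, ihs hρ h.2⟩

theorem Flat.of_ren {ρ : Ren Θ Θ'} (hρ : ∀ B x w, ρ B x = d'.var B w → x = d.var B w)
    {t : CTm Θ o} (h : Flat d' (CTm.ren ρ t)) : Flat d t := by
  induction t generalizing Θ' with
  | var v => trivial
  | mvar Δ A n s ih =>
    refine ⟨h.1, fun B v => (h.2.1 B v).imp_right ?_, ih hρ h.2.2⟩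
    rintro ⟨w, hw⟩
    rw [lookup_ren] at hw
    obtain ⟨x, hx, hxw⟩ := exists_of_ren_eq_var hw
    exact ⟨w, hx.trans (congrArg var (hρ B x w hxw))⟩
  | app a b iha ihb => exact ⟨iha hρ h.1, ihb hρ h.2⟩
  | lam a ih =>
    refine ih (d := d.succ) (d' := d'.succ) (fun B x w hx => ?_) h
    cases x with
    | zero => cases hx
    | succ x => exact congrArg Var.succ (hρ _ _ _ (by injection hx))
  | nil => trivial
  | cons a s iha ihs => exact ⟨iha hρ h.1, ihs hρ h.2⟩

theorem Flat.sub {τ : Env Θ Θ'} (hvar : ∀ B w, τ B (d.var B w) = var (d'.var B w))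
    (hτ : ∀ B v, Flat d' (τ B v)) {t : CTm Θ o} (h : Flat d t) : Flat d' (sub τ t) := by
  induction t generalizing Θ' with
  | var v => exact hτ _ _
  | mvar Δ A n s ih =>
    refine ⟨h.1, fun B v => (h.2.1 B v).imp_right ?_, ih hvar hτ h.2.2⟩
    rintro ⟨w, hw⟩
    exact ⟨w, by simp only [lookup_sub, hw, CTm.sub, hvar]⟩
  | app a b iha ihb => exact ⟨iha hvar hτ h.1, ihb hvar hτ h.2⟩
  | lam a ih =>
    refine ih (d := d.succ) (d' := d'.succ)
      (fun B w => congrArg (CTm.ren Ren.succ) (hvar B w)) (fun B v => ?_) h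
    cases v with
    | zero => trivial
    | succ v => exact (hτ B v).ren fun _ _ => rfl
  | nil => trivial
  | cons a s iha ihs => exact ⟨iha hvar hτ h.1, ihs hvar hτ h.2⟩

theorem Step.flat {t t' : CTm Θ o} (h : Step t t') (ht : Flat d t) : Flat d t' := by
  induction h with
  | beta a b =>
    refine Flat.sub (d := d.succ) (τ := single b) (fun _ _ => rfl) (fun B v => ?_) ht.1
    cases v with
    | zero => exact ht.2
    | succ v => trivial
  | eta hp =>
    subst hp
    exact Flat.of_ren (d' := d.succ) (fun B x w hx => by injection hx) ht.1
  | mvar Δ A n h ih =>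
    refine ⟨ht.1, fun B v => (ht.2.1 B v).imp_right ?_, ih ht.2.2⟩
    rintro ⟨w, hw⟩
    refine ⟨w, ?_⟩
    rcases h.lookup v with heq | hstep
    · rw [← heq, hw]
    · rw [hw] at hstep; cases hstep
  | appL b _ ih => exact ⟨ih ht.1, ht.2⟩
  | appR a _ ih => exact ⟨ht.1, ih ht.2⟩
  | lam _ ih => exact ih (d := d.succ) ht
  | consL s _ ih => exact ⟨ih ht.1, ht.2⟩
  | consR a _ ih => exact ⟨ht.1, ih ht.2⟩

theorem Steps.flat {t t' : CTm Θ o} (h : Steps t t') (ht : Flat d t) : Flat d t' := by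
  induction h with
  | refl => exact ht
  | tail _ h ih => exact h.flat ih

theorem flat_tab_var (d : Depth Γ Θ) (ρ : Ren Δ Θ) : Flat d (tab fun _ v => var (ρ _ v)) := by
  induction Δ with
  | nil => trivial
  | cons A Δ ih => exact ⟨trivial, ih _⟩

theorem flat_eval_lamsMVar (d : Depth Γ Θ) {A : Ty ι} (hA : A.order ≤ 2) (y : ℕ)
    (hd : ∀ B (v : Var Θ B), B.IsAtomic ∨ ∃ w, v = d.var B w) :
    Flat d (Exp.lamsMVar A Θ y).eval := by
  induction A generalizing Θ with
  | base i =>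
    refine ⟨⟨i, rfl⟩, fun B v => (hd B v).imp_right ?_, flat_tab_var d fun _ v => v⟩
    rintro ⟨w, rfl⟩
    exact ⟨w, by rw [lookup_tab]⟩
  | arrow A B _ ih =>
    refine ih d.succ ((le_max_right _ _).trans hA) fun C v => ?_
    cases v with
    | zero => exact .inl (Ty.isAtomic_of_order_arrow_le_two hA)
    | succ v => exact (hd C v).imp_right fun ⟨w, hw⟩ => ⟨w, congrArg Var.succ hw⟩

theorem flat_value (ν : Ctx ι → Ty ι → ℕ → ℕ) (d : Depth Γ Θ) (a : Lam Θ A)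
    (h : ∀ X ∈ a.mvars, X.1.order ≤ 2) : Flat d (a.value ν d) := by
  induction a with
  | var v => trivial
  | mvar A n =>
    exact (flat_eval_lamsMVar .zero (h (A, n) rfl) _ fun B v => .inr ⟨v, rfl⟩).ren fun _ _ => rfl
  | app a b iha ihb =>
    exact ⟨iha d fun X hX => h X (.inl hX), ihb d fun X hX => h X (.inr hX)⟩
  | lam a ih => exact ih d.succ h

end Flat

/-! ### Grafting irreducible terms -/

theorem not_isLam_of_isAtomic (hA : A.IsAtomic) (t : CTm Γ (.ty A)) : ¬ IsLam t := by
  obtain ⟨i, rfl⟩ := hA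
  cases t <;> exact id

namespace Irred

theorem ren {t : CTm Γ o} (h : Irred t) (ρ : Ren Γ Δ) : Irred (ren ρ t) := fun _ hstep =>
  have ⟨t', _, hstep'⟩ := exists_of_step_ren ρ t hstep
  h t' hstep'

theorem app {a : CTm Γ (.ty (.arrow A B))} {b : CTm Γ (.ty A)} (ha : Irred a) (hb : Irred b)
    (hlam : ¬ IsLam a) : Irred (app a b) := by
  intro t h
  cases h with
  | beta => exact hlam trivial
  | appL _ h => exact ha _ h
  | appR _ h => exact hb _ h

theorem not_isLam_of_app {a : CTm Γ (.ty (.arrow A B))} {b : CTm Γ (.ty A)}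
    (h : Irred (CTm.app a b)) : ¬ IsLam a := by
  cases a with
  | lam a => exact (h _ (.beta _ _)).elim
  | _ => exact id

end Irred

/-- Substitutions by irreducible terms that are variables unless their type is atomic. They create
no redex when substituted in an irreducible term. -/
structure IsAtomicOrVar (τ : Env Γ Δ) : Prop where
  irred : ∀ A v, Irred (τ A v)
  isAtomic_or_var : ∀ A v, A.IsAtomic ∨ ∃ w, τ A v = var w

namespace IsAtomicOrVar

variable {τ : Env Γ Δ}

theorem liftEnv (hτ : IsAtomicOrVar τ) (B : Ty ι) : IsAtomicOrVar (liftEnv τ B) where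
  irred
    | _, .zero => irred_var _
    | _, .succ v => (hτ.irred _ v).ren _
  isAtomic_or_var
    | _, .zero => .inr ⟨_, rfl⟩
    | _, .succ v => (hτ.isAtomic_or_var _ v).imp_right fun ⟨w, hw⟩ =>
        ⟨.succ w, congrArg (ren Ren.succ) hw⟩

theorem not_isLam_sub (hτ : IsAtomicOrVar τ) {t : CTm Γ (.ty A)} (ht : ¬ IsLam t) :
    ¬ IsLam (sub τ t) := by
  cases t with
  | var v =>
    rcases hτ.isAtomic_or_var _ v with hA | ⟨w, hw⟩
    · exact not_isLam_of_isAtomic hA _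
    · rw [sub, hw]; exact id
  | lam a => exact (ht trivial).elim
  | _ => exact id

theorem irred_sub (hτ : IsAtomicOrVar τ) {t : CTm Γ o} (ht : Irred t) : Irred (sub τ t) := by
  induction t generalizing Δ with
  | var v => exact hτ.irred _ v
  | mvar Θ A n s ih =>
    intro c hc
    cases hc with
    | mvar _ _ _ hc => exact ih hτ (fun _ h => ht _ (.mvar _ _ _ h)) _ hc
  | app a b iha ihb =>
    exact (iha hτ fun _ h => ht _ (.appL _ h)).app (ihb hτ fun _ h => ht _ (.appR _ h))
      (hτ.not_isLam_sub ht.not_isLam_of_app)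
  | lam a ih =>
    intro c hc
    simp only [sub] at hc
    generalize ha : sub (CTm.liftEnv τ _) a = a' at hc
    cases hc with
    | lam hc => subst ha; exact ih (hτ.liftEnv _) (fun _ h => ht _ (.lam h)) _ hc
    | eta hp =>
      obtain ⟨p, rfl, rfl⟩ := exists_of_sub_liftEnv_eq_app_zero ha
      obtain ⟨p', rfl, -⟩ := exists_shift_of_sub_liftEnv hp
      exact ht _ (.eta rfl)
  | nil => exact nofun
  | cons a s iha ihs =>
    intro c hc
    cases hc with
    | consL _ hc => exact iha hτ (fun _ h => ht _ (.consL _ h)) _ hc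
    | consR _ hc => exact ihs hτ (fun _ h => ht _ (.consR _ h)) _ hc

end IsAtomicOrVar

variable {U : ∀ (Γ : Ctx ι) (A : Ty ι), ℕ → CTm Γ (.ty A)}

/-- The grafted term is irreducible, of order at most `2` and not an abstraction. -/
structure GraftNeutral (U : ∀ (Γ : Ctx ι) (A : Ty ι), ℕ → CTm Γ (.ty A)) (t : CTm Γ (.ty A)) :
    Prop where
  order_le : A.order ≤ 2
  irred : Irred (graft U t)
  not_isLam : ¬ IsLam (graft U t)

/-- The induction hypothesis for `graftNeutralObj`, for terms and for tuples; abstractions are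
exempt, since no inductive step passes below them. -/
def GraftNeutralObj (U : ∀ (Γ : Ctx ι) (A : Ty ι), ℕ → CTm Γ (.ty A)) :
    ∀ {o : Obj ι}, CTm Γ o → Prop
  | .ty _, t => ¬ IsLam t → GraftNeutral U t
  | .cx _, s => ∀ B v, ¬ IsLam (lookup s B v) → GraftNeutral U (lookup s B v)

theorem GraftNeutral.mvar {s : CTm Γ (.cx Δ)} {n : ℕ} (hU : Irred (U Δ A n)) (hA : A.IsAtomic)
    (hs : IsAtomicOrVar (lookup (graft U s))) : GraftNeutral U (mvar Δ A n s) where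
  order_le := by
    obtain ⟨i, rfl⟩ := hA
    exact one_le_two
  irred := hs.irred_sub hU
  not_isLam := not_isLam_of_isAtomic hA _

theorem graftNeutralObj (hU : ∀ Γ A n, Irred (U Γ A n)) {t : CTm Γ o}
    (hΓ : ∀ B ∈ Γ, B.order ≤ 2) (ht : Irred t) (hflat : Flat (.zero : Depth Γ Γ) t) :
    GraftNeutralObj U t := by
  induction t with
  | var v => exact fun _ => ⟨hΓ _ v.mem, irred_var _, id⟩
  | mvar Δ A n s ih =>
    obtain ⟨hA, hatomic, hs⟩ := hflat
    have ih := ih hΓ (fun _ h => ht _ (.mvar _ _ _ h)) hs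
    refine fun _ => .mvar (hU _ _ _) hA ?_
    rw [lookup_graft]
    refine ⟨fun B v => ?_, fun B v => (hatomic B v).imp_right fun ⟨w, hw⟩ => ⟨w, by rw [hw]; rfl⟩⟩
    rcases hatomic B v with hB | ⟨w, hw⟩
    · exact (ih B v (not_isLam_of_isAtomic hB _)).irred
    · rw [hw]; exact irred_var w
  | app a b iha ihb =>
    intro _
    have ha := iha hΓ (fun _ h => ht _ (.appL _ h)) hflat.1 ht.not_isLam_of_app
    have hb := ihb hΓ (fun _ h => ht _ (.appR _ h)) hflat.2
      (not_isLam_of_isAtomic (Ty.isAtomic_of_order_arrow_le_two ha.order_le) _)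
    exact ⟨(le_max_right _ _).trans ha.order_le, ha.irred.app hb.irred ha.not_isLam, id⟩
  | lam => exact fun h => (h trivial).elim
  | nil => exact nofun
  | cons a s iha ihs =>
    intro B v
    cases v with
    | zero => exact iha hΓ (fun _ h => ht _ (.consL _ h)) hflat.1
    | succ v => exact ihs hΓ (fun _ h => ht _ (.consR _ h)) hflat.2 B v

end CTm

namespace Exp

open CTm

variable {ι : Type u} {Γ : Ctx ι} {A : Ty ι} {a b : Lam Γ A} {ν : Ctx ι → Ty ι → ℕ → ℕ}
  {a' b' : Exp (.tm Γ A)} {U : ∀ (Γ : Ctx ι) (A : Ty ι), ℕ → CTm Γ (.ty A)}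

theorem IsNormalFormOf.irred_graft (ha : a'.IsNormalFormOf (a.precook.expand ν))
    (hU : ∀ Δ B m, Irred (U Δ B m)) (hA : A.IsAtomic) (hΓ : ∀ B ∈ Γ, B.order ≤ 2)
    (hmvars : ∀ X ∈ a.mvars, X.1.order ≤ 2) : Irred (CTm.graft U a'.eval) := by
  have hsteps := ha.eval_steps
  rw [Lam.eval_expand_precook] at hsteps
  have hflat := hsteps.flat (flat_value ν .zero a hmvars)
  exact (graftNeutralObj hU hΓ ha.irred_eval hflat (not_isLam_of_isAtomic hA _)).irred

theorem IsNormalFormOf.join_inst_graft (ha : a'.IsNormalFormOf (a.precook.expand ν))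
    {θ : ∀ A : Ty ι, ℕ → Lam Γ A}
    (hθ : ∀ X ∈ a.mvars,
      Join (θ X.1 X.2).embed (CTm.graft U (lamsMVar X.1 Γ (ν Γ X.1 X.2)).eval)) :
    Join (Lam.inst θ a).embed (CTm.graft U a'.eval) :=
  (equivalence_join _ _).trans (Lam.join_embed_instAt ν θ U .zero a hθ)
    ⟨_, ha.steps_graft_value U, .refl⟩

theorem hasSigmaSolution_of_graft_eval_eq (h : CTm.graft U a'.eval = CTm.graft U b'.eval) :
    HasSigmaSolution a' b' := by
  have eval_reify : (fun Δ B n => eval (reify (U Δ B n))) = U := by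
    funext Δ B n
    exact evalObj_reify (U Δ B n)
  exact ⟨fun Δ B n => reify (U Δ B n),
    sigmaConv_of_eval_eq (by rw [eval_graft, eval_graft, eval_reify, h])⟩

theorem hasSigmaSolution_of_hasSolution (hab : Lam.IsSecondOrder a b)
    (hν : Set.InjOn (newMVar ν) (a.precook.mvars ∪ b.precook.mvars))
    (ha : a'.IsNormalFormOf (a.precook.expand ν)) (hb : b'.IsNormalFormOf (b.precook.expand ν))
    (h : Lam.HasSolution a b) : HasSigmaSolution a' b' := by
  obtain ⟨θ, hθ⟩ := h
  obtain ⟨U, hU, hsteps⟩ := exists_irred_steps_lams ν hν fun A n => (θ A n).embed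
  have hjoin : ∀ X : Ty ι × ℕ, (Γ, X) ∈ a.precook.mvars ∪ b.precook.mvars →
      Join (θ X.1 X.2).embed (CTm.graft U (lamsMVar X.1 Γ (ν Γ X.1 X.2)).eval) := by
    intro X hX
    rw [graft_eval_lamsMVar]
    exact (equivalence_join _ _).trans ⟨_, .refl, steps_lams_body X.1 _⟩
      ⟨_, hsteps X.1 X.2 hX, .refl⟩
  have join_a := ha.join_inst_graft fun X h =>
    hjoin X (.inl (Lam.mem_mvars_precookAt .zero a h))
  have join_b := hb.join_inst_graft fun X h =>
    hjoin X (.inr (Lam.mem_mvars_precookAt .zero b h))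
  have irred_a := ha.irred_graft hU hab.atomic hab.ctx fun X h => hab.mvars X (.inl h)
  have irred_b := hb.irred_graft hU hab.atomic hab.ctx fun X h => hab.mvars X (.inr h)
  have join_ab := (equivalence_join _ _).trans join_a.symm
    ((equivalence_join _ _).trans hθ.embed join_b)
  exact hasSigmaSolution_of_graft_eval_eq (irred_a.eq_of_join irred_b join_ab)

end Exp

theorem mainTheorem2 {ι : Type u} {Γ : Ctx ι} {A : Ty ι} (a b : Lam Γ A)
    (hab : Lam.IsSecondOrder a b) (ν : Ctx ι → Ty ι → ℕ → ℕ)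
    (hν : Exp.IsNew ν (a.precook.mvars ∪ b.precook.mvars)) :
    (∃! a' : Exp (.tm Γ A), a'.IsNormalFormOf (a.precook.expand ν)) ∧
    (∃! b' : Exp (.tm Γ A), b'.IsNormalFormOf (b.precook.expand ν)) ∧
    ∀ a' b' : Exp (.tm Γ A),
      a'.IsNormalFormOf (a.precook.expand ν) → b'.IsNormalFormOf (b.precook.expand ν) →
        (Lam.HasSolution a b ↔ Exp.HasSigmaSolution a' b') :=
  ⟨Exp.existsUnique_isNormalFormOf _, Exp.existsUnique_isNormalFormOf _, fun _ _ ha hb =>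
    ⟨Exp.hasSigmaSolution_of_hasSolution hab hν.1 ha hb,
      Exp.hasSolution_of_hasSigmaSolution ha hb⟩⟩
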